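/- **Setting.** Fix $d\ge 2$. For $n\ge 0$ let $H=(H_1,\dots,H_n)$ be a polynomial map $\mathbb C^n\to\mathbb C^n$ with every $H_i$ homogeneous of degree $d$, written $H_i=\sum_{|\alpha|=d}\frac{H_{i,\alpha}}{\alpha!}X^\alpha$, let $L=\max_{i,\,|\alpha|=d}|H_{i,\alpha}|$, let $JH=(\partial H_i/\partial X_j)_{i,j}$, and let $F=I-H$. The map $F$ has a unique formal power series inverse at the origin (with $F^{-1}(0)=0$); let $g_{i,\alpha}$ denote the coefficient of $X^\alpha$ in $F_i^{-1}$. For $k\ge1$ and $|\alpha|=(d-1)k+1$ put $$B_{\alpha}(L)=\frac1{(d!)^k}\,\frac{1}{(d-1)k+1}\binom{dk}{k}\,n^{k-1}\,\frac{|\alpha|!}{\alpha!}\,L^k .$$ Let $\mathcal C_k^{(d)}$ be the (finite) set of rooted planar trees with $k$ internal vertices in which every vertex has $0$ or $d$ children. Given a tree $T\in\mathcal C_k^{(d)}$ and an ancestral path $(v_0,\dots,v_p)$ in $T$ (each $v_{l}$ a child of $v_{l-1}$), the associated length-$p$ shuffle class is the set of all trees obtained from $T$ by permuting, among their $(d-1)p$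 positions, the subtrees subtended by the siblings of $v_1,\dots,v_p$. For $f:\mathcal C_k^{(d)}\to\mathbb C$ put $\|f\|_1=\frac{1}{\#\mathcal C_k^{(d)}}\sum_{T}|f(T)|$, and let $\mathbf 1$ be the constant function $1$. **Theorem.** 1. For all such $H$, all $k\ge1$, all $i$ and all $\alpha$ with $|\alpha|=(d-1)k+1$: $|g_{i,\alpha}|\le B_\alpha(L)$. 2. This is sharp: for every $n\ge1$ and $L\ge0$ there is such an $H$ with $\max_{i,|\alpha|=d}|H_{i,\alpha}|=L$ for which $|g_{i,\alpha}|=B_\alpha(L)$ for all $k\ge 1$, all $i$ and all $\alpha$ with $|\alpha|=(d-1)k+1$. 3. If $(JH)^p=0$ for some $p\ge1$, then for all $k\ge1$, every $\phi$ in the complex linear span of the indicator functions of the length-$p$ shuffle classes of $\mathcal C^{(d)}_k$, all $i$ and all $\alpha$ with $|\alpha|=(d-1)k+1$: $|g_{i,\alpha}|\le B_\alpha(L)\,\|\phi-\mathbf 1\|_1$. 4. In particular, for every $p\ge1$ there are constants $C,c>0$ depending only on $d$ and $p$ such that for every $k\ge1$ some $\phi$ in that span satisfies $\|\phi-\mathbf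 1\|_1\le Ce^{-ck}$, and such that, for every $n$ and every such $H$ with $(JH)^p=0$, $|g_{i,\alpha}|\le B_\alpha(L)\,Ce^{-ck}$ for all $k\ge1$, all $i$ and all $\alpha$ with $|\alpha|=(d-1)k+1$. 5. Consequently, for every $n$ there are $C,c>0$ depending only on $d$ and $n$ such that, whenever $F=I-H$ is a Keller map ($\det JF$ is a nonzero constant), $|g_{i,\alpha}|\le B_\alpha(L)\,Ce^{-ck}$ for all $k\ge1$, all $i$ and all $\alpha$ with $|\alpha|=(d-1)k+1$. -/

import Mathlib

namespace KellerTree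

/-! ### Planar `d`-ary trees -/

/-- Rooted planar `d`-ary trees: every vertex is a leaf or has `d` linearly ordered children. -/
inductive DTree (d : ℕ) : Type
  | leaf : DTree d
  | node (children : Fin d → DTree d) : DTree d

/-- The number of internal (that is, non-leaf) vertices. -/
def DTree.numInternal {d : ℕ} : DTree d → ℕ
  | .leaf => 0
  | .node c => 1 + ∑ j, (c j).numInternal

/-- The set `𝒞_k^{(d)}` of `d`-Catalan trees with `k` internal vertices. -/
def CatalanTree (d k : ℕ) : Type := {T : DTree d // T.numInternal = k}

theorem DTree.finite_numInternal_le (d k : ℕ) :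
    {T : DTree d | T.numInternal ≤ k}.Finite := by
  induction k with
  | zero =>
    refine (Set.finite_singleton (DTree.leaf : DTree d)).subset ?_
    rintro (_ | c) hT
    · rfl
    · simp [DTree.numInternal] at hT
  | succ k ih =>
    have hpi : {c : Fin d → DTree d | ∀ j, (c j).numInternal ≤ k}.Finite := by
      have := Set.Finite.pi (ι := Fin d) (fun _ => ih)
      refine this.subset ?_
      intro c hc j _
      exact hc j
    refine ((hpi.image DTree.node).union (Set.finite_singleton DTree.leaf)).subset ?_
    rintro (_ | c) hT
    · exact Or.inr rfl
    · refine Or.inl ⟨c, fun j => ?_, rfl⟩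
      have h1 : (c j).numInternal ≤ ∑ j, (c j).numInternal :=
        Finset.single_le_sum (f := fun j => (c j).numInternal) (fun _ _ => Nat.zero_le _)
          (Finset.mem_univ j)
      simp only [DTree.numInternal, Set.mem_ofPred_eq] at hT
      omega

instance (d k : ℕ) : Finite (CatalanTree d k) :=
  ((DTree.finite_numInternal_le d k).subset
    (fun _ (hT : DTree.numInternal _ = k) => hT.le)).to_subtype

noncomputable instance (d k : ℕ) : Fintype (CatalanTree d k) := Fintype.ofFinite _

/-! ### Shuffle classes -/

/-- The positions of the siblings off a path `(v_0, …, v_p)`, where `v_{l+1}` is the child number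
`a l` of `v_l`: the position `(l, j)` with `j ≠ a l` is the child number `j` of `v_l`. There are
`(d - 1) p` of them. -/
abbrev Slot {d p : ℕ} (a : Fin p → Fin d) : Type := {s : Fin p × Fin d // s.2 ≠ a s.1}

/-- The tree whose root `v_0` starts a path `(v_0, …, v_p)` where `v_{l+1}` is the child number
`a l` of `v_l`, where the sibling at position `s` subtends the subtree `W s`, and where the last
vertex `v_p` subtends the subtree `B`. -/
def DTree.spine {d : ℕ} : {p : ℕ} → (a : Fin p → Fin d) → (W : Slot a → DTree d) →
    (B : DTree d) → DTree d
  | 0, _, _, B => B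
  | _ + 1, a, W, B => .node fun j =>
      if h : j = a 0 then
        DTree.spine (fun l => a l.succ) (fun s => W ⟨(s.1.1.succ, s.1.2), s.2⟩) B
      else W ⟨(0, j), h⟩

/-- Length-`p` shuffle classes in `𝒞_k^{(d)}`. A tree `T` with a length-`p` ancestral path
`(v_0, …, v_p)` is written as `T = spine u V (spine a W B)`: the first spine (of any length
`m ≥ 0`) is the path from the root to `v_0`, the second one is `(v_0, …, v_p)`. The shuffle class
`Sh(T; v_0, …, v_p)` consists of all the trees obtained by permuting the `(d - 1) p` subtrees
`W s` among the sibling positions of the path, across all generations. -/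
def IsShuffleClass {d k : ℕ} (p : ℕ) (S : Set (CatalanTree d k)) : Prop :=
  ∃ (m : ℕ) (u : Fin m → Fin d) (V : Slot u → DTree d)
    (a : Fin p → Fin d) (W : Slot a → DTree d) (B : DTree d),
    (DTree.spine u V (DTree.spine a W B)).numInternal = k ∧
    S = {T' | ∃ σ : Equiv.Perm (Slot a),
          T'.1 = DTree.spine u V (DTree.spine a (fun s => W (σ s)) B)}

/-- The linear span of the indicator functions of the length-`p` shuffle classes. -/
noncomputable def shuffleSpan (d k p : ℕ) : Submodule ℂ (CatalanTree d k → ℂ) :=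
  Submodule.span ℂ {f | ∃ S : Set (CatalanTree d k), IsShuffleClass p S ∧
    f = S.indicator (fun _ => (1 : ℂ))}

/-- The normalised norm `‖f‖₁ = (1 / #𝒞_k^{(d)}) ∑_T |f(T)|`. -/
noncomputable def norm1 {d k : ℕ} (f : CatalanTree d k → ℂ) : ℝ :=
  (∑ T, ‖f T‖) / (Fintype.card (CatalanTree d k) : ℝ)

/-! ### Polynomial maps and their inverses -/

/-- The map `F = I - H`. -/
noncomputable def idSub {n : ℕ} (H : Fin n → MvPolynomial (Fin n) ℂ) :
    Fin n → MvPolynomial (Fin n) ℂ :=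
  fun i => MvPolynomial.X i - H i

/-- The Jacobian matrix `(∂F_i / ∂X_j)_{i,j}`. -/
noncomputable def jacobian {n : ℕ} (F : Fin n → MvPolynomial (Fin n) ℂ) :
    Matrix (Fin n) (Fin n) (MvPolynomial (Fin n) ℂ) :=
  Matrix.of fun i j => MvPolynomial.pderiv j (F i)

/-- Keller maps: the Jacobian determinant is a nonzero constant. -/
def IsKeller {n : ℕ} (F : Fin n → MvPolynomial (Fin n) ℂ) : Prop :=
  ∃ c : ℂ, c ≠ 0 ∧ (jacobian F).det = MvPolynomial.C c

/-- `G` is the formal power series inverse of `F` at the origin: `G(0) = 0`, `F ∘ G = I` and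
`G ∘ F = I` (used for `F` with `F(0) = 0`, where the second substitution is well defined). -/
def IsInverse {n : ℕ} (F : Fin n → MvPolynomial (Fin n) ℂ)
    (G : Fin n → MvPowerSeries (Fin n) ℂ) : Prop :=
  (∀ i, MvPowerSeries.constantCoeff (G i) = 0) ∧
  (∀ i, MvPolynomial.aeval G (F i) = MvPowerSeries.X i) ∧
  (∀ i, MvPowerSeries.subst (fun j => (F j : MvPowerSeries (Fin n) ℂ)) (G i)
    = (MvPowerSeries.X i : MvPowerSeries (Fin n) ℂ))

/-- `α! = α_1! ⋯ α_n!`. -/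
def multiFactorial {n : ℕ} (α : Fin n →₀ ℕ) : ℕ := ∏ i, (α i).factorial

/-- The coefficient `H_{i,α}` in `H_i = ∑_α (H_{i,α} / α!) X^α`. -/
noncomputable def hcoeff {n : ℕ} (H : Fin n → MvPolynomial (Fin n) ℂ) (i : Fin n)
    (α : Fin n →₀ ℕ) : ℂ :=
  (multiFactorial α : ℂ) * (H i).coeff α

/-- `L = max |H_{i,α}|`, over all `i` and all multi-indices with `|α| = d`. -/
noncomputable def maxCoeff {n : ℕ} (d : ℕ) (H : Fin n → MvPolynomial (Fin n) ℂ) : NNReal :=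
  (Finset.univ ×ˢ Finset.finsuppAntidiag (Finset.univ : Finset (Fin n)) d).sup
    fun q => ‖hcoeff H q.1 q.2‖₊

/-- `(1/(d!)^k) (1/((d-1)k+1)) binom(dk,k) n^{k-1} (|α|!/α!) L^k`, for `k ≥ 1`. -/
noncomputable def coeffBound (d n k : ℕ) (α : Fin n →₀ ℕ) (L : ℝ) : ℝ :=
  1 / ((d.factorial : ℝ) ^ k) * (1 / (((d : ℝ) - 1) * k + 1)) * ((d * k).choose k : ℝ)
    * (n : ℝ) ^ (k - 1) * ((α.degree.factorial : ℝ) / (multiFactorial α : ℝ)) * L ^ k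

end KellerTree

/-!
The inverse series solves `G = X + H(G)`. Iterating this equation expands `G_i` as a sum over
`d`-ary trees, each internal vertex carrying the symmetric `d`-linear form polarizing `H` and each
leaf carrying `X`. The coefficients of the form are at most `L / d!` in modulus, so every tree
weight is dominated by its value for constant coefficients, where it depends only on the number of
internal vertices; the Fuss–Catalan count then gives `B_α(L)`, with equality for constant
coefficients.

Summing the weights over a shuffle class symmetrizes the product of matrices along the path.
By inclusion–exclusion (polarization) such a symmetrization vanishes if it does so on the diagonal,
where the product is a multiple of `(JH) ^ p` evaluated at a point. So the weights are orthogonal to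
the span of the shuffle indicators when `(JH) ^ p = 0`, and `φ - 1` may replace `-1` as the vector
of coefficients of the expansion. A path all of whose siblings are leaves is a shuffle class by
itself, so the indicator of the trees containing such a path lies in the span, and the proportion
of trees avoiding it decays exponentially.

For Keller maps, homogeneity turns `det (1 - JH) = c` into `det (1 - t ^ (d - 1) JH) = c`, so the
characteristic polynomial of `JH` is `t ^ n` and `(JH) ^ n = 0` by Cayley–Hamilton.
-/

namespace KellerTree

/-! ### Trees of bounded height -/

namespace DTree

variable {d : ℕ}

theorem numInternal_child_lt (c : Fin d → DTree d) (j : Fin d) :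
    (c j).numInternal < (node c).numInternal := by
  have : (c j).numInternal ≤ ∑ j, (c j).numInternal :=
    Finset.single_le_sum_of_canonicallyOrdered (f := fun j => (c j).numInternal)
      (Finset.mem_univ j)
  rw [numInternal]
  omega

end DTree

open Classical in
/-- The leaf together with the trees all of whose principal subtrees lie in `s`. -/
noncomputable def graft {d : ℕ} (s : Finset (DTree d)) : Finset (DTree d) :=
  insert .leaf ((Fintype.piFinset fun _ : Fin d => s).image .node)

/-- The `d`-ary trees all of whose root-to-leaf paths have fewer than `h` edges. -/
noncomputable def treesUpTo (d : ℕ) : ℕ → Finset (DTree d)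
  | 0 => ∅
  | h + 1 => graft (treesUpTo d h)

/-- The generating polynomial, evaluated at `x`, of a finite set of trees counted by their
internal vertices. -/
noncomputable def treeGen {d : ℕ} {A : Type*} [CommSemiring A] (s : Finset (DTree d)) (x : A) : A :=
  ∑ T ∈ s, x ^ T.numInternal

section Graft

variable {d : ℕ} {s : Finset (DTree d)}

theorem leaf_mem_graft : DTree.leaf ∈ graft s := by
  simp [graft]

theorem node_mem_graft {c : Fin d → DTree d} : .node c ∈ graft s ↔ ∀ j, c j ∈ s := by
  simp [graft]

theorem sum_graft {A : Type*} [AddCommMonoid A] (s : Finset (DTree d)) (f : DTree d → A) :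
    ∑ T ∈ graft s, f T = f .leaf + ∑ c ∈ Fintype.piFinset fun _ : Fin d => s, f (.node c) := by
  classical
  rw [graft, Finset.sum_insert (by simp), Finset.sum_image]
  exact fun c _ c' _ hcc => DTree.node.inj hcc

theorem treeGen_graft {A : Type*} [CommSemiring A] (s : Finset (DTree d)) (x : A) :
    treeGen (graft s) x = 1 + x * treeGen s x ^ d := by
  have hpow : treeGen s x ^ d
      = ∑ c ∈ Fintype.piFinset fun _ : Fin d => s, ∏ j, x ^ (c j).numInternal := by
    rw [← Finset.prod_univ_sum (fun _ => s) fun _ T => x ^ T.numInternal, Finset.prod_const,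
      Finset.card_univ, Fintype.card_fin, treeGen]
  rw [treeGen, sum_graft, hpow, Finset.mul_sum]
  simp only [DTree.numInternal, pow_zero, pow_add, pow_one, Finset.prod_pow_eq_pow_sum]

end Graft

theorem mem_treesUpTo_of_numInternal_lt {d h : ℕ} {T : DTree d} (hT : T.numInternal < h) :
    T ∈ treesUpTo d h := by
  induction h generalizing T with
  | zero => omega
  | succ h ih =>
    rcases T with _ | c
    · exact leaf_mem_graft
    · exact node_mem_graft.2 fun j => ih (by have := DTree.numInternal_child_lt c j; omega)

theorem sum_catalanTree {A : Type*} [AddCommMonoid A] {d k h : ℕ} (hk : k < h)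
    (f : DTree d → A) :
    ∑ T : CatalanTree d k, f T.1 = ∑ T ∈ treesUpTo d h with T.numInternal = k, f T := by
  refine Finset.sum_bij (fun T _ => T.1) (fun T _ => ?_) (fun _ _ _ _ hTT => Subtype.ext hTT)
    (fun T hT => ⟨⟨T, (Finset.mem_filter.1 hT).2⟩, Finset.mem_univ _, rfl⟩) fun _ _ => rfl
  exact Finset.mem_filter.2 ⟨mem_treesUpTo_of_numInternal_lt (T.2.trans_lt hk), T.2⟩

/-! ### The Fuss–Catalan numbers -/

section FussCatalan

open PowerSeries

/-- The generating function of `d`-ary trees. -/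
noncomputable def treeSeries (d : ℕ) : PowerSeries ℚ :=
  .mk fun k => (Fintype.card (CatalanTree d k) : ℚ)

theorem X_pow_dvd_treeSeries_sub (d h : ℕ) :
    (X : PowerSeries ℚ) ^ h ∣ treeSeries d - treeGen (treesUpTo d h) X := by
  refine X_pow_dvd_iff.2 fun k hk => ?_
  have hcoeff : coeff k (treeGen (treesUpTo d h) (X : PowerSeries ℚ))
      = ∑ _ : CatalanTree d k, (1 : ℚ) := by
    rw [sum_catalanTree hk fun _ => (1 : ℚ), Finset.sum_filter, treeGen, map_sum]
    simp only [coeff_X_pow, eq_comm]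
  simp [hcoeff, treeSeries]

theorem treeSeries_eq (d : ℕ) : treeSeries d = 1 + X * treeSeries d ^ d := by
  ext k
  rw [← sub_eq_zero, ← map_sub]
  refine X_pow_dvd_iff.1 ?_ k (Nat.lt_succ_self k)
  have hpow : X ^ k ∣ treeSeries d ^ d - treeGen (treesUpTo d k) X ^ d :=
    (X_pow_dvd_treeSeries_sub d k).trans (sub_dvd_pow_sub_pow _ _ d)
  have hsucc := X_pow_dvd_treeSeries_sub d (k + 1)
  rw [treesUpTo, treeGen_graft] at hsucc
  convert hsucc.sub (pow_succ' (X : PowerSeries ℚ) k ▸ mul_dvd_mul_left X hpow) using 1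
  ring

/-- The three terms are the coefficients of `X ^ (k + 1)` in `t ^ r`, `X * t ^ (r + d)` and
`t ^ (r + 1)`, for `t = treeSeries d`. -/
theorem fussCatalan_recurrence {d k r N : ℕ} (hN : N = d * (k + 1) + r) (hN0 : N ≠ 0) :
    (r : ℚ) / N * N.choose (k + 1) + (r + d : ℚ) / N * N.choose k
      = (r + 1 : ℚ) / (N + 1) * (N + 1).choose (k + 1) := by
  have hchoose : ((N + 1).choose (k + 1) : ℚ) = (N + 1) * N.choose k / (k + 1) := by
    rw [eq_div_iff (by positivity)]
    exact_mod_cast (Nat.add_one_mul_choose_eq N k).symm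
  have hpascal : (N.choose (k + 1) : ℚ) = (N + 1) * N.choose k / (k + 1) - N.choose k := by
    rw [← hchoose, Nat.choose_succ_succ]
    push_cast
    ring
  have hN' : (N : ℚ) = d * (k + 1) + r := by exact_mod_cast hN
  have hN0' : (N : ℚ) ≠ 0 := by exact_mod_cast hN0
  rw [hchoose, hpascal]
  field_simp
  rw [hN']
  ring

theorem coeff_treeSeries_pow {d : ℕ} (hd : d ≠ 0) {k r : ℕ} (h : k + r ≠ 0) :
    coeff k (treeSeries d ^ r) = (r : ℚ) / ↑(d * k + r) * (d * k + r).choose k := by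
  induction k generalizing r with
  | zero =>
    have h0 : constantCoeff (treeSeries d) = 1 := by rw [treeSeries_eq]; simp
    have hr : (r : ℚ) ≠ 0 := by simpa using h
    simp [h0, hr]
  | succ k ihk =>
    induction r with
    | zero => simp [coeff_one]
    | succ r ihr =>
      have hpow : treeSeries d ^ (r + 1) = treeSeries d ^ r + X * treeSeries d ^ (r + d) := by
        linear_combination treeSeries d ^ r * treeSeries_eq d
      rw [hpow, map_add, coeff_succ_X_mul, ihr (by omega), ihk (by omega),
        show d * k + (r + d) = d * (k + 1) + r by ring, ← add_assoc]
      have := fussCatalan_recurrence (d := d) (k := k) (r := r) rfl (by positivity)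
      push_cast at this ⊢
      exact this

theorem card_catalanTree {d : ℕ} (hd : d ≠ 0) (k : ℕ) :
    (Fintype.card (CatalanTree d k) : ℝ)
      = 1 / (((d : ℝ) - 1) * k + 1) * ((d * k).choose k : ℝ) := by
  have hcard : (Fintype.card (CatalanTree d k) : ℝ) * (d * k + 1) = (d * k + 1).choose k := by
    have h := coeff_treeSeries_pow hd (k := k) (r := 1) (by omega)
    rw [pow_one, treeSeries, coeff_mk, Nat.cast_one, one_div_mul_eq_div,
      eq_div_iff (by positivity)] at h
    exact_mod_cast h
  have hle : k ≤ d * k := Nat.le_mul_of_pos_left k (Nat.pos_of_ne_zero hd)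
  have hcast : ((d * k + 1 - k : ℕ) : ℝ) = ((d : ℝ) - 1) * k + 1 := by
    rw [Nat.cast_sub (by omega)]
    push_cast
    ring
  have hchoose : ((d * k).choose k : ℝ) * (d * k + 1)
      = (d * k + 1).choose k * (((d : ℝ) - 1) * k + 1) := by
    rw [← hcast]
    exact_mod_cast Nat.choose_mul_succ_eq (d * k) k
  have hpos : ((d : ℝ) - 1) * k + 1 ≠ 0 := by
    rw [← hcast]
    exact_mod_cast (by omega : d * k + 1 - k ≠ 0)
  rw [one_div_mul_eq_div, eq_div_iff hpos]
  refine mul_right_cancel₀ (by positivity : (d * k + 1 : ℝ) ≠ 0) ?_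
  linear_combination (((d : ℝ) - 1) * k + 1) * hcard - hchoose

end FussCatalan

section BinomialMode

variable {N e j k : ℕ}

theorem choose_mul_pow_le_succ (hj : j < N) (h : e * (j + 1) ≤ N - j) :
    N.choose j * e ^ (N - j) ≤ N.choose (j + 1) * e ^ (N - (j + 1)) := by
  rw [show N - j = N - (j + 1) + 1 by omega, pow_succ', ← mul_assoc]
  refine Nat.mul_le_mul_right _ (Nat.le_of_mul_le_mul_right ?_ j.succ_pos)
  rw [Nat.succ_eq_add_one, Nat.choose_succ_right_eq, mul_assoc]
  exact Nat.mul_le_mul_left _ h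

theorem choose_mul_pow_succ_le (h : N - j ≤ e * (j + 1)) :
    N.choose (j + 1) * e ^ (N - (j + 1)) ≤ N.choose j * e ^ (N - j) := by
  rcases Nat.lt_or_ge j N with hj | hj
  · rw [show N - j = N - (j + 1) + 1 by omega, pow_succ', ← mul_assoc]
    refine Nat.mul_le_mul_right _ (Nat.le_of_mul_le_mul_right ?_ j.succ_pos)
    rw [Nat.succ_eq_add_one, Nat.choose_succ_right_eq, mul_assoc]
    exact Nat.mul_le_mul_left _ h
  · simp [Nat.choose_eq_zero_of_lt (Nat.lt_succ_of_le hj)]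

theorem choose_mul_pow_le_mode (hN : N = (e + 1) * k) :
    N.choose j * e ^ (N - j) ≤ N.choose k * e ^ (N - k) := by
  rw [add_one_mul] at hN
  rcases le_total j k with hjk | hjk
  · refine monotoneOn_of_le_add_one (f := fun i => N.choose i * e ^ (N - i)) Set.ordConnected_Iic
      (fun i _ _ hi => ?_) (Set.mem_Iic.2 hjk) (Set.mem_Iic.2 le_rfl) hjk
    have := Nat.mul_le_mul_left e (Set.mem_Iic.1 hi)
    have := Set.mem_Iic.1 hi
    exact choose_mul_pow_le_succ (by omega) (by omega)
  · refine antitoneOn_of_add_one_le (f := fun i => N.choose i * e ^ (N - i)) Set.ordConnected_Ici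
      (fun i _ hi _ => ?_) (Set.mem_Ici.2 le_rfl) (Set.mem_Ici.2 hjk) hjk
    have := Nat.mul_le_mul_left e (Set.mem_Ici.1 hi)
    have := Set.mem_Ici.1 hi
    exact choose_mul_pow_succ_le (by rw [mul_add_one]; omega)

theorem add_one_pow_le_choose_mul (e k : ℕ) :
    (e + 1) ^ ((e + 1) * k) ≤ ((e + 1) * k + 1) * (((e + 1) * k).choose k * e ^ (e * k)) := by
  rw [add_comm e 1, add_pow]
  refine (Finset.sum_le_card_nsmul _ _ (((1 + e) * k).choose k * e ^ (e * k)) fun j _ => ?_).trans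
    (by simp)
  rw [one_pow, one_mul, mul_comm, show e * k = (1 + e) * k - k by rw [one_add_mul]; omega]
  exact choose_mul_pow_le_mode (by rw [add_comm])

end BinomialMode

/-! ### Spines and subtrees -/

theorem sum_slot {A : Type*} [AddCommMonoid A] {d p : ℕ} (a : Fin p → Fin d) (f : Slot a → A) :
    ∑ s, f s = ∑ l, ∑ j : {j // j ≠ a l}, f ⟨(l, j), j.2⟩ := by
  rw [← Fintype.sum_sigma']
  exact Fintype.sum_equiv (Equiv.subtypeProdEquivSigmaSubtype fun l j => j ≠ a l) _ _ fun _ => rfl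

namespace DTree

variable {d : ℕ}

theorem numInternal_spine {p : ℕ} (a : Fin p → Fin d) (W : Slot a → DTree d) (B : DTree d) :
    (spine a W B).numInternal = p + ∑ s, (W s).numInternal + B.numInternal := by
  induction p with
  | zero => simp [spine]
  | succ p ih =>
    have hoff (j : {j // j ≠ a 0}) :
        (if h : (j : Fin d) = a 0 then spine (fun l => a l.succ)
            (fun s => W ⟨(s.1.1.succ, s.1.2), s.2⟩) B else W ⟨(0, j), h⟩) = W ⟨(0, j), j.2⟩ :=
      dif_neg j.2
    rw [spine, numInternal, Fintype.sum_eq_add_sum_subtype_ne _ (a 0), dif_pos rfl, ih, sum_slot,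
      sum_slot, Fin.sum_univ_succ]
    simp only [hoff]
    ring

theorem spine_injective {p : ℕ} {a : Fin p → Fin d} {W W' : Slot a → DTree d} {B B' : DTree d}
    (h : spine a W B = spine a W' B') : W = W' ∧ B = B' := by
  induction p with
  | zero => exact ⟨funext fun s => s.1.1.elim0, h⟩
  | succ p ih =>
    have hchild := congrFun (node.inj h)
    have hpath := hchild (a 0)
    rw [dif_pos rfl, dif_pos rfl] at hpath
    obtain ⟨hW, hB⟩ := ih hpath
    refine ⟨funext ?_, hB⟩
    rintro ⟨⟨l, j⟩, hj⟩
    induction l using Fin.cases with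
    | zero => simpa only [dif_neg hj] using hchild j
    | succ l => exact congrFun hW ⟨(l, j), hj⟩

/-- `IsSubtree P T`: the tree `P` is the subtree subtended by some vertex of `T`. -/
inductive IsSubtree (P : DTree d) : DTree d → Prop
  | refl : IsSubtree P P
  | child (c : Fin d → DTree d) (j : Fin d) : IsSubtree P (c j) → IsSubtree P (.node c)

theorem isSubtree_leaf_iff {P : DTree d} : IsSubtree P .leaf ↔ P = .leaf :=
  ⟨fun h => by cases h; rfl, fun h => h ▸ .refl⟩

theorem isSubtree_node_iff {P : DTree d} {c : Fin d → DTree d} :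
    IsSubtree P (.node c) ↔ P = .node c ∨ ∃ j, IsSubtree P (c j) := by
  refine ⟨fun h => ?_, ?_⟩
  · cases h with
    | refl => exact .inl rfl
    | child _ j h => exact .inr ⟨j, h⟩
  · rintro (rfl | ⟨j, h⟩)
    exacts [.refl, .child c j h]

theorem IsSubtree.numInternal_le {P T : DTree d} (h : IsSubtree P T) :
    P.numInternal ≤ T.numInternal := by
  induction h with
  | refl => exact le_rfl
  | child c j _ ih => exact ih.trans (numInternal_child_lt c j).le

theorem IsSubtree.exists_spine {P T : DTree d} (h : IsSubtree P T) :
    ∃ (m : ℕ) (u : Fin m → Fin d) (V : Slot u → DTree d), T = spine u V P := by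
  induction h with
  | refl => exact ⟨0, Fin.elim0, fun s => s.1.1.elim0, rfl⟩
  | child c j _ ih =>
    obtain ⟨m, u, V, hV⟩ := ih
    refine ⟨m + 1, Fin.cons j u, fun s => Fin.cases
      (motive := fun l => (i : Fin d) → i ≠ (Fin.cons j u : Fin (m + 1) → Fin d) l → DTree d)
      (fun i _ => c i) (fun l i h => V ⟨(l, i), h⟩) s.1.1 s.1.2 s.2, ?_⟩
    refine congrArg node (funext fun i => ?_)
    by_cases hi : i = j
    · subst hi
      rw [dif_pos (by simp)]
      exact hV
    · rw [dif_neg (by simpa using hi)]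
      rfl

/-- The comb with `p` internal vertices: a path all of whose siblings are leaves. -/
def comb (j : Fin d) (p : ℕ) : DTree d :=
  spine (fun _ : Fin p => j) (fun _ => .leaf) .leaf

end DTree

open DTree

/-- Shuffling leaves does nothing, so a path whose siblings and end are leaves gives a one-element
class. -/
theorem isShuffleClass_singleton {d k p : ℕ} {j : Fin d} {T : CatalanTree d k}
    (h : IsSubtree (comb j p) T.1) : IsShuffleClass p {T} := by
  obtain ⟨m, u, V, hV⟩ := h.exists_spine
  refine ⟨m, u, V, fun _ => j, fun _ => .leaf, .leaf, (congrArg numInternal hV).symm.trans T.2, ?_⟩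
  ext T'
  simp only [Set.mem_singleton_iff, Set.mem_ofPred_eq, exists_const]
  exact Subtype.ext_iff.trans (by rw [hV, comb])

theorem indicator_isSubtree_mem_shuffleSpan {d : ℕ} (k p : ℕ) (j : Fin d) :
    {T : CatalanTree d k | IsSubtree (comb j p) T.1}.indicator (fun _ => (1 : ℂ))
      ∈ shuffleSpan d k p := by
  classical
  have hsum : {T : CatalanTree d k | IsSubtree (comb j p) T.1}.indicator (fun _ => (1 : ℂ))
      = ∑ T : CatalanTree d k with IsSubtree (comb j p) T.1,
        ({T} : Set (CatalanTree d k)).indicator fun _ => (1 : ℂ) := by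
    ext T
    simp [Finset.sum_apply, Set.indicator_apply]
  rw [hsum]
  exact Submodule.sum_mem _ fun T hT => Submodule.subset_span
    ⟨{T}, isShuffleClass_singleton (Finset.mem_filter.1 hT).2, rfl⟩

/-! ### Trees avoiding a fixed subtree -/

open Classical in
/-- The trees of `treesUpTo d h` that do not contain `P` as a subtree. -/
noncomputable def avoiding {d : ℕ} (P : DTree d) (h : ℕ) : Finset (DTree d) :=
  {T ∈ treesUpTo d h | ¬ IsSubtree P T}

theorem mem_avoiding {d : ℕ} {P T : DTree d} {h : ℕ} :
    T ∈ avoiding P h ↔ T ∈ treesUpTo d h ∧ ¬ IsSubtree P T := by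
  simp [avoiding]

open Classical in
theorem avoiding_succ {d : ℕ} (P : DTree d) (h : ℕ) :
    avoiding P (h + 1) = (graft (avoiding P h)).erase P := by
  ext T
  rcases T with _ | c
  · simp [mem_avoiding, treesUpTo, leaf_mem_graft, isSubtree_leaf_iff, eq_comm]
  · simp only [mem_avoiding, treesUpTo, node_mem_graft, isSubtree_node_iff, Finset.mem_erase,
      not_or, not_exists, forall_and, eq_comm (a := P), ne_eq]
    tauto

theorem mem_graft_avoiding {d : ℕ} {P : DTree d} {h : ℕ} (hP : P.numInternal ≤ h) :
    P ∈ graft (avoiding P h) := by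
  rcases P with _ | c
  · exact leaf_mem_graft
  · refine node_mem_graft.2 fun j => mem_avoiding.2 ?_
    have := numInternal_child_lt c j
    exact ⟨mem_treesUpTo_of_numInternal_lt (by omega), fun hj => by
      have := hj.numInternal_le; omega⟩

theorem treeGen_avoiding_succ {d : ℕ} {A : Type*} [CommRing A] {P : DTree d} {h : ℕ}
    (hP : P.numInternal ≤ h) (x : A) :
    treeGen (avoiding P (h + 1)) x
      = 1 + x * treeGen (avoiding P h) x ^ d - x ^ P.numInternal := by
  classical
  rw [← treeGen_graft, avoiding_succ, treeGen, Finset.sum_erase_eq_sub (mem_graft_avoiding hP),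
    treeGen]

theorem treeGen_nonneg {d : ℕ} (s : Finset (DTree d)) {x : ℝ} (hx : 0 ≤ x) : 0 ≤ treeGen s x :=
  Finset.sum_nonneg fun _ _ => pow_nonneg hx _

theorem treeGen_avoiding_le {d : ℕ} (P : DTree d) (h : ℕ) {x : ℝ} (hx : 0 ≤ x) :
    treeGen (avoiding P h) x ≤ treeGen (treesUpTo d h) x :=
  Finset.sum_le_sum_of_subset_of_nonneg (fun _ hT => (mem_avoiding.1 hT).1)
    fun _ _ _ => pow_nonneg hx _

theorem continuous_treeGen {d : ℕ} (s : Finset (DTree d)) :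
    Continuous (treeGen s : ℝ → ℝ) :=
  continuous_finsetSum _ fun _ _ => continuous_pow _

/-- The radius of convergence of the generating function of `d`-ary trees. -/
noncomputable def treeRadius (d : ℕ) : ℝ := ((d : ℝ) - 1) ^ (d - 1) / (d : ℝ) ^ d

section Radius

variable {d : ℕ}

theorem treeRadius_pos (hd : 2 ≤ d) : 0 < treeRadius d := by
  have : (2 : ℝ) ≤ d := by exact_mod_cast hd
  have : 0 < (d : ℝ) - 1 := by linarith
  unfold treeRadius
  positivity

/-- `d / (d - 1)` is the value of the generating function at its radius of convergence. -/
theorem one_add_treeRadius_mul (hd : 2 ≤ d) :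
    1 + treeRadius d * ((d : ℝ) / (d - 1)) ^ d = d / (d - 1) := by
  have h2 : (2 : ℝ) ≤ d := by exact_mod_cast hd
  have h1 : (d : ℝ) - 1 ≠ 0 := by linarith
  rw [treeRadius, div_pow, div_mul_div_cancel₀ (by positivity),
    ← mul_pow_sub_one (by omega : d ≠ 0) ((d : ℝ) - 1)]
  field_simp
  ring

theorem treeGen_treeRadius_lt (hd : 2 ≤ d) (h : ℕ) :
    treeGen (treesUpTo d h) (treeRadius d) < d / (d - 1) := by
  have h2 : (2 : ℝ) ≤ d := by exact_mod_cast hd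
  have h1 : 0 < (d : ℝ) - 1 := by linarith
  have hr := treeRadius_pos hd
  induction h with
  | zero =>
    rw [treesUpTo, treeGen, Finset.sum_empty]
    positivity
  | succ h ih =>
    have hpow := pow_lt_pow_left₀ ih (treeGen_nonneg _ hr.le) (by omega : d ≠ 0)
    calc treeGen (treesUpTo d (h + 1)) (treeRadius d)
        = 1 + treeRadius d * treeGen (treesUpTo d h) (treeRadius d) ^ d := treeGen_graft _ _
      _ < 1 + treeRadius d * ((d : ℝ) / (d - 1)) ^ d := by gcongr
      _ = d / (d - 1) := one_add_treeRadius_mul hd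

/-- Deleting `x ^ P.numInternal` from the recursion leaves room to move slightly beyond the
radius of convergence. -/
theorem exists_treeGen_avoiding_le (hd : 2 ≤ d) (P : DTree d) :
    ∃ x, treeRadius d < x ∧ ∀ h, treeGen (avoiding P h) x ≤ d / (d - 1) := by
  have hr := treeRadius_pos hd
  have hsmall : ∀ᶠ x : ℝ in nhds (treeRadius d), ∀ h ∈ Finset.range (P.numInternal + 1),
      treeGen (treesUpTo d h) x < (d : ℝ) / (d - 1) :=
    (Filter.eventually_all_finset _).2 fun h _ =>
      (continuous_treeGen _).continuousAt.eventually_lt continuousAt_const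
        (treeGen_treeRadius_lt hd h)
  have hstep : ∀ᶠ x in nhds (treeRadius d),
      1 + x * ((d : ℝ) / (d - 1)) ^ d - x ^ P.numInternal < d / (d - 1) := by
    refine ContinuousAt.eventually_lt
      (f := fun x : ℝ => 1 + x * ((d : ℝ) / (d - 1)) ^ d - x ^ P.numInternal)
      (by fun_prop) continuousAt_const ?_
    linarith [one_add_treeRadius_mul hd, pow_pos hr P.numInternal]
  obtain ⟨x, ⟨hx_small, hx_step⟩, hx⟩ :=
    (((hsmall.and hstep).filter_mono nhdsWithin_le_nhds).and
      (self_mem_nhdsWithin (s := Set.Ioi (treeRadius d)))).exists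
  have hx0 : 0 ≤ x := hr.le.trans (le_of_lt hx)
  refine ⟨x, hx, fun h => ?_⟩
  induction h with
  | zero =>
    exact (treeGen_avoiding_le P _ hx0).trans (hx_small 0 (by simp)).le
  | succ h ih =>
    rcases le_or_gt P.numInternal h with hP | hP
    · rw [treeGen_avoiding_succ hP]
      refine le_trans ?_ hx_step.le
      have := treeGen_nonneg (avoiding P h) hx0
      gcongr
    · exact (treeGen_avoiding_le P _ hx0).trans (hx_small _ (by simpa using hP)).le

end Radius

/-! ### The constant function is exponentially close to the shuffle span -/

theorem one_le_card_mul_treeRadius_pow {d : ℕ} (hd : d ≠ 0) (k : ℕ) :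
    1 ≤ (Fintype.card (CatalanTree d k) : ℝ) * (d * k + 1) ^ 2 * treeRadius d ^ k := by
  rw [card_catalanTree hd, treeRadius]
  obtain ⟨e, rfl⟩ := Nat.exists_eq_succ_of_ne_zero hd
  have hsum : ((e : ℝ) + 1) ^ ((e + 1) * k)
      ≤ ((e + 1) * k + 1) * (((e + 1) * k).choose k * (e : ℝ) ^ (e * k)) := by
    exact_mod_cast add_one_pow_le_choose_mul e k
  have hratio : 1 ≤ (((e : ℝ) + 1) * k + 1) / (e * k + 1) := by
    rw [one_le_div (by positivity)]
    nlinarith [(k.cast_nonneg : (0 : ℝ) ≤ k)]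
  rw [Nat.succ_eq_add_one, div_pow, ← pow_mul, ← pow_mul, Nat.cast_add_one, add_sub_cancel_right,
    Nat.add_sub_cancel]
  calc (1 : ℝ)
      ≤ (((e : ℝ) + 1) * k + 1) / (e * k + 1)
          * (((e + 1) * k + 1) * (((e + 1) * k).choose k * (e : ℝ) ^ (e * k))
            / (e + 1) ^ ((e + 1) * k)) :=
        one_le_mul_of_one_le_of_one_le hratio ((one_le_div (by positivity)).2 hsum)
    _ = _ := by ring

open Classical in
theorem norm1_indicator_sub_one {d k : ℕ} (P : CatalanTree d k → Prop) :
    norm1 (fun T => {T | P T}.indicator (fun _ => (1 : ℂ)) T - 1)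
      = ({T | ¬ P T} : Finset (CatalanTree d k)).card / Fintype.card (CatalanTree d k) := by
  rw [norm1, Finset.card_filter, Nat.cast_sum]
  refine congrArg (· / _) (Finset.sum_congr rfl fun T _ => ?_)
  by_cases h : P T <;> simp [h]

open Classical in
theorem card_not_isSubtree_mul_pow_le {d : ℕ} (P : DTree d) (k : ℕ) {x : ℝ} (hx : 0 ≤ x) :
    (({T | ¬ IsSubtree P T.1} : Finset (CatalanTree d k)).card : ℝ) * x ^ k
      ≤ treeGen (avoiding P (k + 1)) x := by
  calc (({T | ¬ IsSubtree P T.1} : Finset (CatalanTree d k)).card : ℝ) * x ^ k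
      = ∑ T ∈ treesUpTo d (k + 1) with T.numInternal = k,
          if ¬ IsSubtree P T then x ^ k else 0 := by
        rw [← nsmul_eq_mul, ← Finset.sum_const, Finset.sum_filter,
          sum_catalanTree k.lt_succ_self fun T => if ¬ IsSubtree P T then x ^ k else 0]
    _ = ∑ T ∈ avoiding P (k + 1) with T.numInternal = k, x ^ T.numInternal := by
        rw [← Finset.sum_filter, Finset.filter_comm, avoiding]
        exact Finset.sum_congr rfl fun T hT => by rw [(Finset.mem_filter.1 hT).2]
    _ ≤ treeGen (avoiding P (k + 1)) x :=
        Finset.sum_le_sum_of_subset_of_nonneg (Finset.filter_subset _ _)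
          fun _ _ _ => pow_nonneg hx _

theorem norm1_indicator_isSubtree_sub_one_le {d : ℕ} (hd : 2 ≤ d) {P : DTree d} {x M : ℝ}
    (hx : 0 < x) (hM : ∀ h, treeGen (avoiding P h) x ≤ M) (k : ℕ) :
    norm1 (fun T => {T : CatalanTree d k | IsSubtree P T.1}.indicator (fun _ => (1 : ℂ)) T - 1)
      ≤ M * (d * k + 1) ^ 2 * (treeRadius d / x) ^ k := by
  classical
  have hcard := one_le_card_mul_treeRadius_pow (by omega : d ≠ 0) k
  have hr := treeRadius_pos hd
  have hpos : 0 < (Fintype.card (CatalanTree d k) : ℝ) := by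
    by_contra! h
    rw [le_antisymm h (Nat.cast_nonneg _)] at hcard
    linarith
  have havoid := (card_not_isSubtree_mul_pow_le P k hx.le).trans (hM (k + 1))
  rw [norm1_indicator_sub_one, div_le_iff₀ hpos]
  refine ((le_div_iff₀ (pow_pos hx k)).2 havoid).trans ?_
  calc M / x ^ k ≤ M / x ^ k * (Fintype.card (CatalanTree d k) * (d * k + 1) ^ 2
        * treeRadius d ^ k) :=
        le_mul_of_one_le_right
          (div_nonneg ((treeGen_nonneg _ hx.le).trans (hM 0)) (pow_nonneg hx.le k)) hcard
    _ = M * (d * k + 1) ^ 2 * (treeRadius d / x) ^ k * Fintype.card (CatalanTree d k) := by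
        rw [div_pow]
        ring

theorem exists_pow_mul_pow_le_exp (m : ℕ) {q : ℝ} (hq0 : 0 < q) (hq1 : q < 1) :
    ∃ C c : ℝ, 0 < C ∧ 0 < c ∧ ∀ k : ℕ, (k : ℝ) ^ m * q ^ k ≤ C * Real.exp (-c * k) := by
  obtain ⟨s, hqs, hs1⟩ := exists_between hq1
  have hs0 := hq0.trans hqs
  have hO := (isLittleO_pow_const_mul_const_pow_const_pow_of_norm_lt (R := ℝ) m
    ((Real.norm_of_nonneg hq0.le).trans_lt hqs)).isBigO
  obtain ⟨C, hC, hbound⟩ := Asymptotics.bound_of_isBigO_nat_atTop hO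
  refine ⟨C, -Real.log s, hC, neg_pos.2 (Real.log_neg hs0 hs1), fun k => ?_⟩
  have hexp : Real.exp (- -Real.log s * k) = s ^ k := by
    rw [neg_neg, mul_comm, Real.exp_nat_mul, Real.exp_log hs0]
  have := hbound (x := k) (pow_ne_zero k hs0.ne')
  rwa [Real.norm_of_nonneg (by positivity), Real.norm_of_nonneg (by positivity), ← hexp] at this

theorem exists_mem_shuffleSpan_norm1_le {d : ℕ} (hd : 2 ≤ d) (p : ℕ) :
    ∃ C c : ℝ, 0 < C ∧ 0 < c ∧ ∀ k : ℕ, 1 ≤ k → ∃ φ ∈ shuffleSpan d k p,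
      norm1 (fun T => φ T - 1) ≤ C * Real.exp (-c * k) := by
  have j : Fin d := ⟨0, by omega⟩
  obtain ⟨x, hx, hM⟩ := exists_treeGen_avoiding_le hd (comb j p)
  have hr := treeRadius_pos hd
  have hx0 : 0 < x := hr.trans hx
  have hd1 : 0 < (d : ℝ) - 1 := sub_pos.2 (by exact_mod_cast hd)
  obtain ⟨C, c, hC, hc, hexp⟩ :=
    exists_pow_mul_pow_le_exp 2 (div_pos hr hx0) ((div_lt_one hx0).2 hx)
  refine ⟨d / (d - 1) * (d + 1) ^ 2 * C, c, by positivity, hc, fun k hk =>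
    ⟨_, indicator_isSubtree_mem_shuffleSpan k p j, ?_⟩⟩
  have hk1 : (1 : ℝ) ≤ k := by exact_mod_cast hk
  have hlin : (d * k + 1 : ℝ) ≤ (d + 1) * k := by linarith
  calc _ ≤ d / (d - 1) * (d * k + 1) ^ 2 * (treeRadius d / x) ^ k :=
        norm1_indicator_isSubtree_sub_one_le hd hx0 hM k
    _ ≤ d / (d - 1) * ((d + 1) * k) ^ 2 * (treeRadius d / x) ^ k := by gcongr
    _ = d / (d - 1) * (d + 1) ^ 2 * (k ^ 2 * (treeRadius d / x) ^ k) := by ring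
    _ ≤ d / (d - 1) * (d + 1) ^ 2 * (C * Real.exp (-c * k)) :=
        mul_le_mul_of_nonneg_left (hexp k) (by positivity)
    _ = d / (d - 1) * (d + 1) ^ 2 * C * Real.exp (-c * k) := by ring

open MvPolynomial

/-! ### Multilinear forms and weights of trees -/

section MultiForm

variable {R A ι : Type*} [CommSemiring R] [CommSemiring A] [Algebra R A] [Fintype ι] {d : ℕ}

/-- The `d`-linear map on `ι → A` with coefficients `h i j`, where `i` is the index of the output
and `j l` is the index of the `l`-th argument. -/
noncomputable def multiForm (h : ι → (Fin d → ι) → R) :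
    MultilinearMap A (fun _ : Fin d => ι → A) (ι → A) :=
  MultilinearMap.pi fun i => ∑ j : Fin d → ι,
    h i j • (MultilinearMap.mkPiAlgebra A (Fin d) A).compLinearMap fun l => LinearMap.proj (j l)

theorem multiForm_apply (h : ι → (Fin d → ι) → R) (y : Fin d → ι → A) (i : ι) :
    multiForm h y i = ∑ j : Fin d → ι, h i j • ∏ l, y l (j l) := by
  simp [multiForm]

theorem map_multiForm {B : Type*} [CommSemiring B] [Algebra R B] (f : A →ₐ[R] B)
    (h : ι → (Fin d → ι) → R) (y : Fin d → ι → A) (i : ι) :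
    f (multiForm h y i) = multiForm h (fun l i => f (y l i)) i := by
  simp only [multiForm_apply, map_sum, map_smul, map_prod]

theorem multiForm_comp_perm {h : ι → (Fin d → ι) → R} {σ : Equiv.Perm (Fin d)}
    (hσ : ∀ i j, h i (j ∘ σ) = h i j) (y : Fin d → ι → A) :
    multiForm h (y ∘ σ) = multiForm h y := by
  ext i
  rw [multiForm_apply, multiForm_apply,
    ← (σ.symm.arrowCongr (Equiv.refl ι)).sum_comp fun j => h i j • ∏ l, (y ∘ σ) l (j l)]
  refine Finset.sum_congr rfl fun j _ => ?_
  rw [show σ.symm.arrowCongr (Equiv.refl ι) j = j ∘ σ from rfl, hσ]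
  exact congrArg _ (Equiv.prod_comp σ fun l => y l (j l))

theorem multiForm_const (c : R) (y : Fin d → ι → A) (i : ι) :
    multiForm (fun _ _ => c) y i = c • ∏ l, ∑ i, y l i := by
  rw [multiForm_apply, ← Finset.smul_sum, ← Fintype.piFinset_univ, ← Finset.prod_univ_sum]

theorem isHomogeneous_multiForm {σ : Type*} (h : ι → (Fin d → ι) → R)
    {y : Fin d → ι → MvPolynomial σ R} {m : Fin d → ℕ} (hy : ∀ l i, (y l i).IsHomogeneous (m l))
    (i : ι) : (multiForm h y i).IsHomogeneous (∑ l, m l) := by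
  rw [multiForm_apply]
  refine IsHomogeneous.sum _ _ _ fun j _ => ?_
  rw [smul_eq_C_mul]
  exact (IsHomogeneous.prod Finset.univ _ m fun l _ => hy l (j l)).C_mul _

/-- The sum, over all labellings of the vertices of a tree with root labelled `i`, of the products
of the coefficients `h` at the internal vertices and of the values of `x` at the leaves. -/
noncomputable def treeWeight (h : ι → (Fin d → ι) → R) (x : ι → A) : DTree d → ι → A
  | .leaf => x
  | .node c => multiForm h fun l => treeWeight h x (c l)

theorem map_treeWeight {B : Type*} [CommSemiring B] [Algebra R B] (f : A →ₐ[R] B)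
    (h : ι → (Fin d → ι) → R) (x : ι → A) (T : DTree d) (i : ι) :
    f (treeWeight h x T i) = treeWeight h (fun i => f (x i)) T i := by
  induction T generalizing i with
  | leaf => rfl
  | node c ih => simp only [treeWeight, map_multiForm, ih]

/-- A tree with `k` internal vertices has `(d - 1) * k + 1` leaves. -/
theorem sum_sub_one_mul_numInternal_add_one (hd : d ≠ 0) (c : Fin d → DTree d) :
    ∑ l, ((d - 1) * (c l).numInternal + 1) = (d - 1) * (node c).numInternal + 1 := by
  obtain ⟨e, rfl⟩ := Nat.exists_eq_add_one_of_ne_zero hd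
  simp only [Finset.sum_add_distrib, ← Finset.mul_sum, numInternal, Finset.sum_const,
    Finset.card_univ, Fintype.card_fin, smul_eq_mul, mul_one, Nat.add_sub_cancel]
  ring

theorem isHomogeneous_treeWeight (hd : d ≠ 0) (h : ι → (Fin d → ι) → R) (T : DTree d) (i : ι) :
    (treeWeight h X T i : MvPolynomial ι R).IsHomogeneous ((d - 1) * T.numInternal + 1) := by
  induction T generalizing i with
  | leaf => simpa [treeWeight, numInternal] using isHomogeneous_X R i
  | node c ih =>
    rw [← sum_sub_one_mul_numInternal_add_one hd]
    exact isHomogeneous_multiForm h ih i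

theorem coeff_treeWeight_eq_zero (hd : 2 ≤ d) (h : ι → (Fin d → ι) → R) {T : DTree d} {k : ℕ}
    (hT : T.numInternal ≠ k) (i : ι) {α : ι →₀ ℕ} (hα : α.degree = (d - 1) * k + 1) :
    (treeWeight h X T i : MvPolynomial ι R).coeff α = 0 := by
  refine (isHomogeneous_treeWeight (by omega) h T i).coeff_eq_zero fun heq => hT ?_
  exact (Nat.eq_of_mul_eq_mul_left (by omega : 0 < d - 1)
    (Nat.add_right_cancel (hα.symm.trans heq))).symm

theorem sum_treeWeight_const (hd : d ≠ 0) (c : R) (x : ι → A) (T : DTree d) :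
    ∑ i, treeWeight (fun _ _ => c) x T i
      = (c * Fintype.card ι) ^ T.numInternal • (∑ i, x i) ^ ((d - 1) * T.numInternal + 1) := by
  induction T with
  | leaf => simp [treeWeight, numInternal]
  | node t ih =>
    simp_rw [treeWeight, multiForm_const, ih]
    rw [Finset.prod_smul, Finset.prod_pow_eq_pow_sum, Finset.prod_pow_eq_pow_sum,
      sum_sub_one_mul_numInternal_add_one hd, Finset.sum_const, Finset.card_univ,
      ← Nat.cast_smul_eq_nsmul R, smul_smul, smul_smul]
    congr 1
    rw [numInternal]
    ring

theorem treeWeight_const (hd : d ≠ 0) (c : R) (x : ι → A) {T : DTree d} {k : ℕ}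
    (hT : T.numInternal = k + 1) (i : ι) :
    treeWeight (fun _ _ => c) x T i
      = (c ^ (k + 1) * (Fintype.card ι : R) ^ k) • (∑ i, x i) ^ ((d - 1) * (k + 1) + 1) := by
  rcases T with _ | t
  · simp [numInternal] at hT
  have hk : ∑ l, (t l).numInternal = k := by rw [numInternal] at hT; omega
  simp_rw [treeWeight, multiForm_const, sum_treeWeight_const hd]
  rw [Finset.prod_smul, Finset.prod_pow_eq_pow_sum, Finset.prod_pow_eq_pow_sum,
    sum_sub_one_mul_numInternal_add_one hd, hT, hk, smul_smul]
  ring_nf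

end MultiForm

/-! ### Symmetric coefficients -/

section SymCoeff

variable {d n : ℕ}

/-- The exponent of the monomial `∏ l, X (j l)`. -/
noncomputable def expo {σ : Type*} (j : Fin d → σ) : σ →₀ ℕ :=
  ∑ l, Finsupp.single (j l) 1

theorem prod_X_eq_monomial_expo {R σ : Type*} [CommSemiring R] (j : Fin d → σ) :
    ∏ l, (X (j l) : MvPolynomial σ R) = monomial (expo j) 1 := by
  rw [expo, monomial_sum_one]
  rfl

theorem degree_expo {σ : Type*} (j : Fin d → σ) : (expo j).degree = d := by
  simp [expo, map_sum]

theorem multiFactorial_ne_zero (α : Fin n →₀ ℕ) : multiFactorial α ≠ 0 :=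
  Finset.prod_ne_zero_iff.2 fun _ _ => Nat.factorial_ne_zero _

theorem coeff_sum_X_pow {K : Type*} [Field K] [CharZero K] (α : Fin n →₀ ℕ) (m : ℕ) :
    ((∑ i, X i : MvPolynomial (Fin n) K) ^ m).coeff α
      = if α.degree = m then (α.degree.factorial : K) / multiFactorial α else 0 := by
  have hα : (multiFactorial α : K) ≠ 0 := by exact_mod_cast multiFactorial_ne_zero α
  rw [coeff_sum_X_pow_of_fintype, show (α.sum fun _ m => m) = α.degree from rfl]
  split_ifs
  · rw [eq_div_iff hα, mul_comm, multiFactorial, Finsupp.degree_eq_sum,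
      Finsupp.multinomial_eq_of_support_subset (Finset.subset_univ _)]
    exact_mod_cast Nat.multinomial_spec Finset.univ α
  · exact Nat.cast_zero

/-- The coefficients of the symmetric `d`-linear form attached to `H i`. -/
noncomputable def symCoeff (d : ℕ) (H : Fin n → MvPolynomial (Fin n) ℂ) (i : Fin n)
    (j : Fin d → Fin n) : ℂ :=
  hcoeff H i (expo j) / d.factorial

theorem symCoeff_comp_perm (H : Fin n → MvPolynomial (Fin n) ℂ) (σ : Equiv.Perm (Fin d))
    (i : Fin n) (j : Fin d → Fin n) : symCoeff d H i (j ∘ σ) = symCoeff d H i j := by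
  have hexpo : expo (j ∘ σ) = expo j :=
    Equiv.sum_comp σ fun l => (Finsupp.single (j l) 1 : Fin n →₀ ℕ)
  rw [symCoeff, symCoeff, hexpo]

variable {H : Fin n → MvPolynomial (Fin n) ℂ}

theorem eq_sum_symCoeff_smul (hH : ∀ i, (H i).IsHomogeneous d) (i : Fin n) :
    H i = ∑ j : Fin d → Fin n, symCoeff d H i j • ∏ l, X (j l) := by
  ext α
  have hcount : ∑ j : Fin d → Fin n, (if expo j = α then (1 : ℂ) else 0)
      = if α.degree = d then (α.degree.factorial : ℂ) / multiFactorial α else 0 := by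
    rw [← coeff_sum_X_pow α d, Fintype.sum_pow]
    simp_rw [prod_X_eq_monomial_expo, coeff_sum, coeff_monomial]
  have hcoeff_sum : coeff α (∑ j : Fin d → Fin n, symCoeff d H i j • ∏ l, X (j l))
      = hcoeff H i α / d.factorial * ∑ j : Fin d → Fin n, if expo j = α then (1 : ℂ) else 0 := by
    rw [coeff_sum, Finset.mul_sum]
    refine Finset.sum_congr rfl fun j _ => ?_
    rw [coeff_smul, prod_X_eq_monomial_expo, coeff_monomial, symCoeff]
    split_ifs with hj
    · rw [hj, smul_eq_mul]
    · simp
  have hα0 : (multiFactorial α : ℂ) ≠ 0 := by exact_mod_cast multiFactorial_ne_zero α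
  rw [hcoeff_sum, hcount]
  split_ifs with hα
  · have hd0 : (d.factorial : ℂ) ≠ 0 := by exact_mod_cast d.factorial_ne_zero
    rw [hα, hcoeff]
    field_simp
  · rw [mul_zero, (hH i).coeff_eq_zero hα]

theorem aeval_eq_multiForm (hH : ∀ i, (H i).IsHomogeneous d) {A : Type*} [CommSemiring A]
    [Algebra ℂ A] (x : Fin n → A) (i : Fin n) :
    aeval x (H i) = multiForm (symCoeff d H) (fun _ => x) i := by
  conv_lhs => rw [eq_sum_symCoeff_smul hH i]
  simp [multiForm_apply]

theorem nnnorm_hcoeff_le_maxCoeff (H : Fin n → MvPolynomial (Fin n) ℂ) (i : Fin n)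
    {α : Fin n →₀ ℕ} (hα : α.degree = d) : ‖hcoeff H i α‖₊ ≤ maxCoeff d H := by
  refine Finset.le_sup (f := fun q : Fin n × (Fin n →₀ ℕ) => ‖hcoeff H q.1 q.2‖₊) (b := (i, α)) ?_
  rw [Finset.mem_product, Finset.mem_finsuppAntidiag, ← Finsupp.degree_eq_sum]
  exact ⟨Finset.mem_univ _, hα, Finset.subset_univ _⟩

theorem norm_symCoeff_le (H : Fin n → MvPolynomial (Fin n) ℂ) (i : Fin n) (j : Fin d → Fin n) :
    ‖symCoeff d H i j‖ ≤ maxCoeff d H / d.factorial := by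
  rw [symCoeff, norm_div, Complex.norm_natCast]
  gcongr
  exact_mod_cast nnnorm_hcoeff_le_maxCoeff H i (degree_expo j)

end SymCoeff

/-! ### Symmetrization over the siblings of a path -/

section Polarization

variable {Q : Type*} [Fintype Q]

theorem sum_neg_one_pow_card_disjoint_range [DecidableEq Q] (r : Q → Q) :
    ∑ U : Finset Q, (if ∀ q, r q ∈ Uᶜ then (-1 : ℤ) ^ U.card else 0)
      = if Function.Bijective r then 1 else 0 := by
  have hU (U : Finset Q) : (∀ q, r q ∈ Uᶜ) ↔ U ∈ (Finset.univ.image r)ᶜ.powerset := by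
    rw [Finset.mem_powerset, Finset.subset_compl_comm, Finset.image_subset_iff]
    simp
  simp_rw [hU, Finset.sum_ite_mem, Finset.univ_inter]
  rw [Finset.sum_powerset_neg_one_pow_card]
  refine if_congr ?_ rfl rfl
  rw [Finset.compl_eq_empty_iff, ← Finset.coe_eq_univ, Finset.coe_image, Finset.coe_univ,
    Set.image_univ, Set.range_eq_univ, Finite.surjective_iff_bijective]

variable {A M N : Type*} [Semiring A] [AddCommMonoid M] [Module A M] [AddCommGroup N] [Module A N]

theorem sum_perm_comp_eq [DecidableEq Q] (f : MultilinearMap A (fun _ : Q => M) N) (y : Q → M) :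
    ∑ σ : Equiv.Perm Q, f (y ∘ σ)
      = ∑ U : Finset Q, (-1 : ℤ) ^ U.card • f fun _ => ∑ t ∈ Uᶜ, y t := by
  calc ∑ σ : Equiv.Perm Q, f (y ∘ σ)
      = ∑ r : Q → Q, (if Function.Bijective r then (1 : ℤ) else 0) • f (y ∘ r) := by
        simp_rw [ite_smul, one_smul, zero_smul]
        rw [← Finset.sum_filter]
        exact (Finset.sum_bij (fun r hr => Equiv.ofBijective r (Finset.mem_filter.1 hr).2)
          (fun _ _ => Finset.mem_univ _) (fun _ _ _ _ h => congrArg DFunLike.coe h)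
          (fun σ _ => ⟨σ, by simp, Equiv.ext fun _ => rfl⟩) fun _ _ => rfl).symm
    _ = ∑ U : Finset Q, ∑ r : Q → Q,
          if ∀ q, r q ∈ Uᶜ then (-1 : ℤ) ^ U.card • f (y ∘ r) else 0 := by
        rw [Finset.sum_comm]
        refine Finset.sum_congr rfl fun r _ => ?_
        rw [← sum_neg_one_pow_card_disjoint_range, Finset.sum_smul]
        simp_rw [ite_smul, zero_smul]
    _ = ∑ U : Finset Q, (-1 : ℤ) ^ U.card • f fun _ => ∑ t ∈ Uᶜ, y t := by
        refine Finset.sum_congr rfl fun U _ => ?_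
        rw [f.map_sum_finset (fun _ => y) fun _ => Uᶜ, Finset.smul_sum, ← Finset.sum_filter]
        exact Finset.sum_congr (by ext; simp) fun _ _ => rfl

theorem sum_perm_comp_eq_zero [DecidableEq Q] {f : MultilinearMap A (fun _ : Q => M) N}
    (hf : ∀ v, f (fun _ => v) = 0) (y : Q → M) : ∑ σ : Equiv.Perm Q, f (y ∘ σ) = 0 := by
  simp only [sum_perm_comp_eq, hf, smul_zero, Finset.sum_const_zero]

end Polarization

section SpineForm

variable {d p : ℕ}

/-- The part of a family indexed by the siblings of a path `(v_0, …, v_{p+1})` that belongs to the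
siblings of `v_1`, with the value `0` at the position of `v_1` itself. -/
def spineHead {M : Type*} [Zero M] (a : Fin (p + 1) → Fin d) (y : Slot a → M) (l : Fin d) : M :=
  if hl : l = a 0 then 0 else y ⟨(0, l), hl⟩

/-- The part of a family indexed by the siblings of a path `(v_0, …, v_{p+1})` that belongs to the
path `(v_1, …, v_{p+1})`. -/
def spineTail {M : Type*} (a : Fin (p + 1) → Fin d) (y : Slot a → M)
    (s : Slot fun l => a l.succ) : M :=
  y ⟨(s.1.1.succ, s.1.2), s.2⟩

theorem spineHead_update_zero {M : Type*} [Zero M] (a : Fin (p + 1) → Fin d) (y : Slot a → M)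
    {j : Fin d} (hj : j ≠ a 0) (v : M) :
    spineHead a (Function.update y ⟨(0, j), hj⟩ v) = Function.update (spineHead a y) j v := by
  funext l
  rcases eq_or_ne l j with rfl | hlj
  · simp [spineHead, hj]
  · simp [spineHead, hlj]

theorem spineTail_update_zero {M : Type*} (a : Fin (p + 1) → Fin d) (y : Slot a → M)
    {j : Fin d} (hj : j ≠ a 0) (v : M) :
    spineTail a (Function.update y ⟨(0, j), hj⟩ v) = spineTail a y := by
  funext s
  simp [spineTail]

theorem spineHead_update_succ {M : Type*} [Zero M] (a : Fin (p + 1) → Fin d) (y : Slot a → M)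
    (s : Slot fun l => a l.succ) (v : M) :
    spineHead a (Function.update y ⟨(s.1.1.succ, s.1.2), s.2⟩ v) = spineHead a y := by
  funext l
  simp [spineHead, (Fin.succ_ne_zero _).symm]

theorem spineTail_update_succ {M : Type*} (a : Fin (p + 1) → Fin d) (y : Slot a → M)
    (s : Slot fun l => a l.succ) (v : M) :
    spineTail a (Function.update y ⟨(s.1.1.succ, s.1.2), s.2⟩ v)
      = Function.update (spineTail a y) s v := by
  funext t
  simp [spineTail, Function.update_apply, Subtype.ext_iff, Prod.ext_iff]

variable {R A ι : Type*} [CommSemiring R] [CommSemiring A] [Algebra R A] [Fintype ι]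

/-- The linear map that takes the weights at the end of a path to the weights at its start, when
the siblings of the path have the weights `y`. -/
noncomputable def spineMap (h : ι → (Fin d → ι) → R) :
    {p : ℕ} → (a : Fin p → Fin d) → (Slot a → ι → A) → Module.End A (ι → A)
  | 0, _, _ => 1
  | _ + 1, a, y => (multiForm h).toLinearMap (spineHead a y) (a 0) *
      spineMap h (fun l => a l.succ) (spineTail a y)

theorem treeWeight_spine (h : ι → (Fin d → ι) → R) (x : ι → A) (a : Fin p → Fin d)
    (W : Slot a → DTree d) (B : DTree d) :
    treeWeight h x (spine a W B)
      = spineMap h a (fun s => treeWeight h x (W s)) (treeWeight h x B) := by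
  induction p with
  | zero => rfl
  | succ p ih =>
    rw [spine, treeWeight, spineMap, Module.End.mul_apply, MultilinearMap.toLinearMap_apply]
    congr 1
    funext l
    rcases eq_or_ne l (a 0) with rfl | hl
    · rw [dif_pos rfl, Function.update_self, ih]
      rfl
    · rw [dif_neg hl, Function.update_of_ne hl, spineHead, dif_neg hl]

theorem spineMap_update_zero (h : ι → (Fin d → ι) → R) (a : Fin (p + 1) → Fin d)
    (y : Slot a → ι → A) {j : Fin d} (hj : j ≠ a 0) (v z : ι → A) :
    spineMap h a (Function.update y ⟨(0, j), hj⟩ v) z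
      = (multiForm h).toLinearMap
          (Function.update (spineHead a y) (a 0)
            (spineMap h (fun l => a l.succ) (spineTail a y) z)) j v := by
  rw [spineMap, spineHead_update_zero, spineTail_update_zero, Module.End.mul_apply,
    MultilinearMap.toLinearMap_apply, MultilinearMap.toLinearMap_apply, Function.update_comm hj]

theorem spineMap_update_succ (h : ι → (Fin d → ι) → R) (a : Fin (p + 1) → Fin d)
    (y : Slot a → ι → A) (s : Slot fun l => a l.succ) (v : ι → A) :
    spineMap h a (Function.update y ⟨(s.1.1.succ, s.1.2), s.2⟩ v)
      = (multiForm h).toLinearMap (spineHead a y) (a 0) *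
          spineMap h (fun l => a l.succ) (Function.update (spineTail a y) s v) := by
  rw [spineMap, spineHead_update_succ, spineTail_update_succ]

theorem exists_linearMap_eq_spineMap_update (h : ι → (Fin d → ι) → R) (a : Fin p → Fin d)
    (y : Slot a → ι → A) (s : Slot a) (z : ι → A) :
    ∃ g : Module.End A (ι → A), ∀ v, spineMap h a (Function.update y s v) z = g v := by
  induction p with
  | zero => exact s.1.1.elim0
  | succ p ih =>
    obtain ⟨⟨l, j⟩, hj⟩ := s
    cases l using Fin.cases with
    | zero => exact ⟨_, fun v => spineMap_update_zero h a y hj v z⟩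
    | succ l =>
      obtain ⟨g, hg⟩ := ih (fun l => a l.succ) (spineTail a y) ⟨(l, j), hj⟩
      refine ⟨(multiForm h).toLinearMap (spineHead a y) (a 0) * g, fun v => ?_⟩
      rw [spineMap_update_succ h a y ⟨(l, j), hj⟩ v, Module.End.mul_apply, hg,
        Module.End.mul_apply]

/-- `spineMap` as a multilinear function of the weights of the siblings of the path. -/
noncomputable def spineForm (h : ι → (Fin d → ι) → R) (a : Fin p → Fin d) (z : ι → A) :
    MultilinearMap A (fun _ : Slot a => ι → A) (ι → A) :=
  MultilinearMap.mk' (fun y => spineMap h a y z)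
    (fun y s v w => by
      obtain ⟨g, hg⟩ := exists_linearMap_eq_spineMap_update h a y s z
      rw [hg, hg, hg, map_add])
    fun y s c v => by
      obtain ⟨g, hg⟩ := exists_linearMap_eq_spineMap_update h a y s z
      rw [hg, hg, map_smul]

end SpineForm

theorem sum_perm_treeWeight_spine_eq_zero {R A ι : Type*} [CommSemiring R] [CommRing A]
    [Algebra R A] [Fintype ι] {d p : ℕ} {h : ι → (Fin d → ι) → R} {a : Fin p → Fin d}
    (hdiag : ∀ y : ι → A, spineMap h a (fun _ => y) = 0) (x : ι → A) (W : Slot a → DTree d)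
    (B : DTree d) {m : ℕ} (u : Fin m → Fin d) (V : Slot u → DTree d) :
    ∑ σ : Equiv.Perm (Slot a), treeWeight h x (spine u V (spine a (W ∘ σ) B)) = 0 := by
  have hsum : ∑ σ : Equiv.Perm (Slot a), treeWeight h x (spine a (W ∘ σ) B) = 0 := by
    simp_rw [treeWeight_spine]
    exact sum_perm_comp_eq_zero (f := spineForm h a (treeWeight h x B))
      (fun y => LinearMap.congr_fun (hdiag y) _) fun s => treeWeight h x (W s)
  simp_rw [treeWeight_spine h x u]
  rw [← map_sum, hsum, map_zero]

/-! ### The Jacobian matrix -/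

section Derivation

variable {R A ι : Type*} [CommSemiring R] [CommSemiring A] [Algebra R A] {d : ℕ}

theorem derivation_prod {κ : Type*} [DecidableEq κ] (D : Derivation R A A) (s : Finset κ)
    (f : κ → A) :
    D (∏ l ∈ s, f l) = ∑ l ∈ s, ∏ q ∈ s, Function.update f l (D (f l)) q := by
  induction s using Finset.induction_on with
  | empty => simp
  | insert b s hb ih =>
    rw [Finset.prod_insert hb, D.leibniz, ih, Finset.sum_insert hb, smul_eq_mul, smul_eq_mul,
      Finset.mul_sum, add_comm, Finset.prod_insert hb, Function.update_self,
      Finset.prod_update_of_notMem hb, mul_comm (D (f b))]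
    congr 1
    refine Finset.sum_congr rfl fun l hl => ?_
    rw [Finset.prod_insert hb, Function.update_of_ne (ne_of_mem_of_not_mem hl hb).symm]

theorem derivation_multiForm [Fintype ι] (D : Derivation R A A) (h : ι → (Fin d → ι) → R)
    (y : Fin d → ι → A) (i : ι) :
    D (multiForm h y i) = ∑ l, multiForm h (Function.update y l fun k => D (y l k)) i := by
  simp_rw [multiForm_apply]
  rw [Finset.sum_comm, map_sum]
  refine Finset.sum_congr rfl fun j _ => ?_
  rw [D.map_smul, derivation_prod, Finset.smul_sum]
  refine Finset.sum_congr rfl fun l _ => congrArg _ (Finset.prod_congr rfl fun q _ => ?_)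
  exact (Function.apply_update (fun q (v : ι → A) => v (j q)) y l (fun k => D (y l k)) q).symm

end Derivation

section Jacobian

variable {A : Type*} [CommRing A] [Algebra ℂ A] {d n p : ℕ} {H : Fin n → MvPolynomial (Fin n) ℂ}

theorem multiForm_symCoeff_update_const (H : Fin n → MvPolynomial (Fin n) ℂ) (x v : Fin n → A)
    (l b : Fin d) :
    multiForm (symCoeff d H) (Function.update (fun _ => x) l v)
      = multiForm (symCoeff d H) (Function.update (fun _ => x) b v) := by
  rw [← multiForm_comp_perm (σ := Equiv.swap l b) (symCoeff_comp_perm H _),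
    Function.update_comp_equiv, Equiv.symm_swap, Equiv.swap_apply_left]
  rfl

theorem pderiv_eq_multiForm (hH : ∀ i, (H i).IsHomogeneous d) (b : Fin d) (i k : Fin n) :
    pderiv k (H i) = d • multiForm (symCoeff d H)
      (Function.update (fun _ => (X : Fin n → MvPolynomial (Fin n) ℂ)) b (Pi.single k 1)) i := by
  have hX : (fun m => pderiv k (X m : MvPolynomial (Fin n) ℂ)) = Pi.single k 1 := by
    funext m
    rw [pderiv_X, Pi.single_comm]
  conv_lhs => rw [← aeval_X_left_apply (H i), aeval_eq_multiForm hH, derivation_multiForm]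
  simp_rw [hX, multiForm_symCoeff_update_const H X _ _ b]
  rw [Finset.sum_const, Finset.card_univ, Fintype.card_fin]

theorem toLin'_jacobian_map_aeval (hH : ∀ i, (H i).IsHomogeneous d) (x : Fin n → A) (b : Fin d) :
    Matrix.toLin' ((jacobian H).map (aeval x))
      = (d : ℂ) • (multiForm (symCoeff d H)).toLinearMap (fun _ => x) b := by
  refine LinearMap.pi_ext' fun k => LinearMap.ext_ring (funext fun i => ?_)
  have hargs : (fun l i => aeval x (Function.update
        (fun _ => (X : Fin n → MvPolynomial (Fin n) ℂ)) b (Pi.single k 1) l i))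
      = Function.update (fun _ => x) b (Pi.single k 1) := by
    funext l m
    rcases eq_or_ne l b with rfl | hl
    · rcases eq_or_ne m k with rfl | hm <;> simp [*]
    · simp [hl]
  calc Matrix.toLin' ((jacobian H).map (aeval x)) (Pi.single k 1) i
      = aeval x (pderiv k (H i)) := by simp [jacobian]
    _ = (d : ℂ) • multiForm (symCoeff d H) (Function.update (fun _ => x) b (Pi.single k 1)) i := by
        rw [pderiv_eq_multiForm hH b, map_nsmul, map_multiForm, hargs, Nat.cast_smul_eq_nsmul]

theorem pow_smul_spineMap_const (hH : ∀ i, (H i).IsHomogeneous d) (x : Fin n → A)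
    (a : Fin p → Fin d) :
    (d : ℂ) ^ p • spineMap (symCoeff d H) a (fun _ => x)
      = Matrix.toLin' ((jacobian H).map (aeval x) ^ p) := by
  induction p with
  | zero => simp [spineMap, Module.End.one_eq_id]
  | succ p ih =>
    have hhead : (multiForm (symCoeff d H)).toLinearMap (spineHead a fun _ => x) (a 0)
        = (multiForm (symCoeff d H)).toLinearMap (fun _ => x) (a 0) := by
      refine LinearMap.ext fun v => ?_
      rw [MultilinearMap.toLinearMap_apply, MultilinearMap.toLinearMap_apply]
      congr 1
      funext l
      rcases eq_or_ne l (a 0) with rfl | hl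
      · simp
      · simp [hl, spineHead]
    rw [spineMap, hhead, pow_succ', pow_succ', Matrix.toLin'_mul,
      toLin'_jacobian_map_aeval hH x (a 0), ← ih fun l => a l.succ, ← Module.End.mul_eq_comp,
      smul_mul_smul_comm]
    rfl

theorem spineMap_const_eq_zero (hd : d ≠ 0) (hH : ∀ i, (H i).IsHomogeneous d)
    (hJ : jacobian H ^ p = 0) (a : Fin p → Fin d) (x : Fin n → A) :
    spineMap (symCoeff d H) a (fun _ => x) = 0 := by
  have hJx : (jacobian H).map (aeval x) ^ p = 0 := by
    have := map_pow (aeval x : MvPolynomial (Fin n) ℂ →ₐ[ℂ] A).mapMatrix (jacobian H) p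
    rw [hJ, map_zero] at this
    exact this.symm
  have hpow := pow_smul_spineMap_const hH x a
  rw [hJx, map_zero] at hpow
  exact (smul_eq_zero_iff_right (pow_ne_zero p (Nat.cast_ne_zero.2 hd))).1 hpow

end Jacobian

/-! ### Orthogonality of tree weights to the shuffle span -/

section Rearrangement

variable {Q β : Type*} [Fintype Q] [DecidableEq Q] [DecidableEq β] (W : Q → β)

/-- The permutations that induce a given rearrangement of a family form a coset. -/
theorem card_filter_comp_perm (σ : Equiv.Perm Q) :
    (Finset.univ.filter fun τ : Equiv.Perm Q => W ∘ τ = W ∘ σ).card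
      = (Finset.univ.filter fun τ : Equiv.Perm Q => W ∘ τ = W).card := by
  refine Finset.card_equiv (Equiv.mulRight σ⁻¹) fun τ => ?_
  rw [Finset.mem_filter_univ, Finset.mem_filter_univ, Equiv.coe_mulRight, Equiv.Perm.coe_mul,
    ← Function.comp_assoc]
  exact (Equiv.comp_symm_eq σ _ _).symm

theorem sum_perm_eq_card_nsmul_sum_image {γ N : Type*} [DecidableEq γ] [AddCommMonoid N]
    {Ψ : Equiv.Perm Q → γ} (hΨ : ∀ σ τ, Ψ σ = Ψ τ ↔ W ∘ σ = W ∘ τ) (w : γ → N) :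
    ∑ σ, w (Ψ σ) = (Finset.univ.filter fun τ : Equiv.Perm Q => W ∘ τ = W).card •
      ∑ T ∈ Finset.univ.image Ψ, w T := by
  rw [Finset.sum_comp, Finset.smul_sum]
  refine Finset.sum_congr rfl fun T hT => ?_
  obtain ⟨σ, -, rfl⟩ := Finset.mem_image.1 hT
  simp_rw [hΨ, card_filter_comp_perm]

end Rearrangement

section ShuffleSpan

variable {A ι : Type*} [CommRing A] [Algebra ℂ A] [Fintype ι] {d p k : ℕ}
  {h : ι → (Fin d → ι) → ℂ}

theorem sum_treeWeight_shuffleClass_eq_zero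
    (hdiag : ∀ (a : Fin p → Fin d) (y : ι → A), spineMap h a (fun _ => y) = 0) (x : ι → A)
    {S : Set (CatalanTree d k)} (hS : IsShuffleClass p S) :
    ∑ T : CatalanTree d k, S.indicator (fun _ => (1 : ℂ)) T • treeWeight h x T.1 = 0 := by
  classical
  obtain ⟨m, u, V, a, W, B, hk, hS⟩ := hS
  have hperm (σ : Equiv.Perm (Slot a)) : (spine u V (spine a (W ∘ σ) B)).numInternal = k := by
    rw [← hk]
    simp only [numInternal_spine, Function.comp_apply]
    rw [Equiv.sum_comp σ fun s => (W s).numInternal]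
  let Ψ (σ : Equiv.Perm (Slot a)) : CatalanTree d k := ⟨_, hperm σ⟩
  have hΨ (σ τ) : Ψ σ = Ψ τ ↔ W ∘ σ = W ∘ τ :=
    ⟨fun heq => (spine_injective (spine_injective (congrArg Subtype.val heq)).2).1,
      fun heq => Subtype.ext (congrArg (fun W => spine u V (spine a W B)) heq)⟩
  have hS_image : S = Finset.univ.image Ψ := by
    rw [hS, Finset.coe_image, Finset.coe_univ, Set.image_univ]
    exact Set.ext fun T => exists_congr fun σ => ⟨fun heq => Subtype.ext heq.symm,
      fun heq => congrArg Subtype.val heq.symm⟩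
  have hsum : ∑ σ, treeWeight h x (Ψ σ).1 = 0 :=
    sum_perm_treeWeight_spine_eq_zero (hdiag a) x W B u V
  rw [sum_perm_eq_card_nsmul_sum_image W hΨ fun T => treeWeight h x T.1,
    ← Nat.cast_smul_eq_nsmul ℂ] at hsum
  have hcard : ((Finset.univ.filter fun τ : Equiv.Perm (Slot a) => W ∘ τ = W).card : ℂ) ≠ 0 :=
    Nat.cast_ne_zero.2 (Finset.card_ne_zero.2 ⟨1, by simp⟩)
  simp_rw [hS_image, Set.indicator_apply, Finset.mem_coe, ite_smul, one_smul, zero_smul]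
  rw [Finset.sum_ite_mem, Finset.univ_inter]
  exact (smul_eq_zero_iff_right hcard).1 hsum

theorem sum_smul_treeWeight_eq_zero_of_mem_shuffleSpan
    (hdiag : ∀ (a : Fin p → Fin d) (y : ι → A), spineMap h a (fun _ => y) = 0) (x : ι → A)
    {φ : CatalanTree d k → ℂ} (hφ : φ ∈ shuffleSpan d k p) :
    ∑ T : CatalanTree d k, φ T • treeWeight h x T.1 = 0 := by
  induction hφ using Submodule.span_induction with
  | mem f hf =>
    obtain ⟨S, hS, rfl⟩ := hf
    exact sum_treeWeight_shuffleClass_eq_zero hdiag x hS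
  | zero => simp
  | add f g _ _ hf hg => simp [add_smul, Finset.sum_add_distrib, hf, hg]
  | smul c f _ hf => simp [mul_smul, ← Finset.smul_sum, hf]

end ShuffleSpan

/-! ### Coefficientwise domination -/

section Dominated

variable {σ 𝕜 : Type*} [NormedCommRing 𝕜]

/-- The coefficients of `f` are bounded in norm by those of `g`, that is, `g` is a majorant
of `f`. -/
def Dominated (f : MvPolynomial σ 𝕜) (g : MvPolynomial σ ℝ) : Prop :=
  ∀ α, ‖f.coeff α‖ ≤ g.coeff α

theorem Dominated.mul {f f' : MvPolynomial σ 𝕜} {g g' : MvPolynomial σ ℝ} (h : Dominated f g)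
    (h' : Dominated f' g') : Dominated (f * f') (g * g') := by
  classical
  intro α
  rw [coeff_mul, coeff_mul]
  exact (norm_sum_le _ _).trans (Finset.sum_le_sum fun q _ => (norm_mul_le _ _).trans
    (mul_le_mul (h _) (h' _) (norm_nonneg _) ((norm_nonneg _).trans (h _))))

theorem Dominated.smul {f : MvPolynomial σ 𝕜} {g : MvPolynomial σ ℝ} (h : Dominated f g) {a : 𝕜}
    {b : ℝ} (hab : ‖a‖ ≤ b) : Dominated (a • f) (b • g) := by
  intro α
  rw [coeff_smul, coeff_smul]
  exact (norm_smul_le _ _).trans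
    (mul_le_mul hab (h α) (norm_nonneg _) ((norm_nonneg _).trans hab))

theorem Dominated.sum {κ : Type*} (s : Finset κ) {f : κ → MvPolynomial σ 𝕜}
    {g : κ → MvPolynomial σ ℝ} (h : ∀ q, Dominated (f q) (g q)) :
    Dominated (∑ q ∈ s, f q) (∑ q ∈ s, g q) := by
  intro α
  rw [coeff_sum, coeff_sum]
  exact (norm_sum_le _ _).trans (Finset.sum_le_sum fun q _ => h q α)

variable [NormOneClass 𝕜]

theorem dominated_monomial_one (β : σ →₀ ℕ) :
    Dominated (monomial β 1 : MvPolynomial σ 𝕜) (monomial β 1) := by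
  classical
  intro α
  rw [coeff_monomial, coeff_monomial]
  split_ifs <;> simp

theorem Dominated.prod {κ : Type*} (s : Finset κ) {f : κ → MvPolynomial σ 𝕜}
    {g : κ → MvPolynomial σ ℝ} (h : ∀ q, Dominated (f q) (g q)) :
    Dominated (∏ q ∈ s, f q) (∏ q ∈ s, g q) := by
  induction s using Finset.cons_induction with
  | empty => exact dominated_monomial_one 0
  | cons a s ha ih =>
    rw [Finset.prod_cons, Finset.prod_cons]
    exact (h a).mul ih

theorem dominated_treeWeight [Fintype σ] {d : ℕ} {h : σ → (Fin d → σ) → 𝕜} {c : ℝ}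
    (hc : ∀ i j, ‖h i j‖ ≤ c) (T : DTree d) (i : σ) :
    Dominated (treeWeight h X T i : MvPolynomial σ 𝕜)
      (treeWeight (fun _ _ => c) X T i : MvPolynomial σ ℝ) := by
  induction T generalizing i with
  | leaf => exact dominated_monomial_one _
  | node t ih =>
    rw [treeWeight, treeWeight, multiForm_apply, multiForm_apply]
    exact Dominated.sum _ fun j => (Dominated.prod _ fun l => ih l (j l)).smul (hc i j)

end Dominated

section TreeBound

variable {d n k : ℕ}

/-- The largest possible coefficient of `X ^ α` in the weight of a single tree with `k` internal
vertices, so that `B_α(L)` is `#𝒞_k^{(d)}` times this bound. -/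
noncomputable def treeBound (d n k : ℕ) (α : Fin n →₀ ℕ) (L : ℝ) : ℝ :=
  (L / d.factorial) ^ k * n ^ (k - 1) * ((α.degree.factorial : ℝ) / multiFactorial α)

theorem coeffBound_eq (hd : d ≠ 0) (n k : ℕ) (α : Fin n →₀ ℕ) (L : ℝ) :
    coeffBound d n k α L = Fintype.card (CatalanTree d k) * treeBound d n k α L := by
  rw [card_catalanTree hd, coeffBound, treeBound, div_pow]
  ring

theorem coeff_treeWeight_const {K : Type*} [Field K] [CharZero K] (hd : d ≠ 0) (hk : k ≠ 0) (c : K)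
    (T : CatalanTree d k) (i : Fin n) {α : Fin n →₀ ℕ} (hα : α.degree = (d - 1) * k + 1) :
    (treeWeight (fun _ _ => c) X T.1 i : MvPolynomial (Fin n) K).coeff α
      = c ^ k * n ^ (k - 1) * ((α.degree.factorial : K) / multiFactorial α) := by
  obtain ⟨k, rfl⟩ := Nat.exists_eq_add_one_of_ne_zero hk
  rw [treeWeight_const hd c _ T.2, coeff_smul, coeff_sum_X_pow, if_pos hα, smul_eq_mul,
    Fintype.card_fin, Nat.add_sub_cancel]

theorem norm_coeff_treeWeight_le (hd : d ≠ 0) (hk : k ≠ 0) (H : Fin n → MvPolynomial (Fin n) ℂ)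
    (T : CatalanTree d k) (i : Fin n) {α : Fin n →₀ ℕ} (hα : α.degree = (d - 1) * k + 1) :
    ‖(treeWeight (symCoeff d H) X T.1 i : MvPolynomial (Fin n) ℂ).coeff α‖
      ≤ treeBound d n k α (maxCoeff d H) :=
  (dominated_treeWeight (norm_symCoeff_le H) T.1 i α).trans_eq
    (coeff_treeWeight_const hd hk _ T i hα)

end TreeBound

section Extremal

variable {d n : ℕ}

/-- The map all of whose coefficients `H_{i,α}` are equal to `L`; it attains the bound. -/
noncomputable def extremal (d n : ℕ) (L : ℂ) : Fin n → MvPolynomial (Fin n) ℂ :=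
  fun _ => (L / d.factorial) • (∑ i, X i) ^ d

theorem isHomogeneous_extremal (d n : ℕ) (L : ℂ) (i : Fin n) :
    (extremal d n L i).IsHomogeneous d := by
  rw [extremal, smul_eq_C_mul]
  simpa only [one_mul] using
    ((IsHomogeneous.sum Finset.univ _ 1 fun i _ => isHomogeneous_X ℂ i).pow d).C_mul _

theorem hcoeff_extremal (L : ℂ) (i : Fin n) {α : Fin n →₀ ℕ} (hα : α.degree = d) :
    hcoeff (extremal d n L) i α = L := by
  have hα0 : (multiFactorial α : ℂ) ≠ 0 := by exact_mod_cast multiFactorial_ne_zero α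
  have hd0 : (d.factorial : ℂ) ≠ 0 := by exact_mod_cast d.factorial_ne_zero
  rw [hcoeff, extremal, coeff_smul, coeff_sum_X_pow, if_pos hα, hα, smul_eq_mul]
  field_simp

theorem symCoeff_extremal (d n : ℕ) (L : ℂ) :
    symCoeff d (extremal d n L) = fun _ _ => L / d.factorial := by
  funext i j
  rw [symCoeff, hcoeff_extremal L i (degree_expo j)]

theorem maxCoeff_extremal (d : ℕ) (hn : n ≠ 0) (L : NNReal) :
    maxCoeff d (extremal d n ((L : ℝ) : ℂ)) = L := by
  have hnorm : ‖((L : ℝ) : ℂ)‖₊ = L := by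
    ext
    simp
  have i : Fin n := ⟨0, by omega⟩
  refine le_antisymm (Finset.sup_le fun q hq => ?_) ?_
  · rw [Finset.mem_product, Finset.mem_finsuppAntidiag, ← Finsupp.degree_eq_sum] at hq
    rw [hcoeff_extremal _ _ hq.2.1, hnorm]
  · have := nnnorm_hcoeff_le_maxCoeff (extremal d n ((L : ℝ) : ℂ)) i
      (Finsupp.degree_single i d)
    rwa [hcoeff_extremal _ _ (Finsupp.degree_single i d), hnorm] at this

end Extremal

/-! ### The inverse power series as a sum over trees -/

section TreeExpansion

variable {R σ : Type*} [CommRing R]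

theorem natCast_le_order_iff {f : MvPowerSeries σ R} {m : ℕ} :
    (m : ℕ∞) ≤ f.order ↔ ∀ α : σ →₀ ℕ, α.degree < m → MvPowerSeries.coeff α f = 0 :=
  ⟨fun h _ hα => MvPowerSeries.coeff_of_lt_order (lt_of_lt_of_le (by exact_mod_cast hα) h),
    fun h => MvPowerSeries.nat_le_order h⟩

theorem le_order_prod_sub_prod {m r : ℕ} {x y : Fin (r + 1) → MvPowerSeries σ R}
    (hx : ∀ l, 1 ≤ (x l).order) (hy : ∀ l, 1 ≤ (y l).order)
    (hxy : ∀ l, (m : ℕ∞) ≤ (x l - y l).order) :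
    (m + r : ℕ∞) ≤ (∏ l, x l - ∏ l, y l).order := by
  induction r with
  | zero => simpa using hxy 0
  | succ r ih =>
    have hprod : (r + 1 : ℕ∞) ≤ (∏ l : Fin (r + 1), y l.succ).order :=
      le_trans (by simpa using Finset.sum_le_sum fun l (_ : l ∈ Finset.univ) => hy (Fin.succ l))
        (MvPowerSeries.le_order_prod _ _)
    have htelescope : ∏ l, x l - ∏ l, y l
        = x 0 * (∏ l : Fin (r + 1), x l.succ - ∏ l : Fin (r + 1), y l.succ)
          + (x 0 - y 0) * ∏ l : Fin (r + 1), y l.succ := by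
      rw [Fin.prod_univ_succ x, Fin.prod_univ_succ y]
      ring
    rw [htelescope, Nat.cast_succ]
    refine (le_min ?_ ?_).trans MvPowerSeries.min_order_le_add
    · rw [← add_assoc, add_comm]
      exact (add_le_add (hx 0) (ih (fun l => hx _) (fun l => hy _) fun l => hxy _)).trans
        MvPowerSeries.le_order_mul
    · exact (add_le_add (hxy 0) hprod).trans MvPowerSeries.le_order_mul

variable {ι : Type*} [Fintype ι] {d : ℕ} {h : ι → (Fin d → ι) → R}

theorem le_order_multiForm_sub (hd : 2 ≤ d) (h : ι → (Fin d → ι) → R) {m : ℕ}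
    {x y : ι → MvPowerSeries σ R} (hx : ∀ i, 1 ≤ (x i).order) (hy : ∀ i, 1 ≤ (y i).order)
    (hxy : ∀ i, (m : ℕ∞) ≤ (x i - y i).order) (i : ι) :
    ((m + 1 : ℕ) : ℕ∞) ≤ (multiForm h (fun _ => x) i - multiForm h (fun _ => y) i).order := by
  obtain ⟨e, rfl⟩ := Nat.exists_eq_add_of_le' hd
  rw [natCast_le_order_iff]
  intro α hα
  rw [multiForm_apply, multiForm_apply, ← Finset.sum_sub_distrib, map_sum]
  refine Finset.sum_eq_zero fun j _ => ?_
  have hprod := le_order_prod_sub_prod (fun l => hx (j l)) (fun l => hy (j l)) fun l => hxy (j l)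
  have hcoeff := natCast_le_order_iff.1 (by exact_mod_cast hprod) α
    (by omega : α.degree < m + (e + 1))
  rw [← smul_sub, map_smul, hcoeff, smul_zero]

theorem sub_multiForm_injective (hd : 2 ≤ d) {x y : ι → MvPowerSeries σ R}
    (hx : ∀ i, 1 ≤ (x i).order) (hy : ∀ i, 1 ≤ (y i).order)
    (hxy : x - multiForm h (fun _ => x) = y - multiForm h (fun _ => y)) : x = y := by
  have hsub (i : ι) : x i - y i = multiForm h (fun _ => x) i - multiForm h (fun _ => y) i :=
    sub_eq_sub_iff_sub_eq_sub.1 (congrFun hxy i)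
  have horder (m : ℕ) (i : ι) : (m : ℕ∞) ≤ (x i - y i).order := by
    induction m generalizing i with
    | zero => simp
    | succ m ih => exact hsub i ▸ le_order_multiForm_sub hd h hx hy ih i
  funext i
  rw [← sub_eq_zero]
  ext α
  exact natCast_le_order_iff.1 (horder (α.degree + 1) i) α (Nat.lt_succ_self _)

/-- The sum of the weights of the trees of height less than `m`: the iterates, starting from `0`,
of the fixed point equation for the inverse of `x ↦ x - multiForm h (fun _ => x)`. -/
noncomputable def treeApprox (h : ι → (Fin d → ι) → R) (m : ℕ) : ι → MvPowerSeries ι R :=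
  ∑ T ∈ treesUpTo d m, treeWeight h MvPowerSeries.X T

theorem treeApprox_succ (h : ι → (Fin d → ι) → R) (m : ℕ) :
    treeApprox h (m + 1) = MvPowerSeries.X + multiForm h fun _ => treeApprox h m := by
  classical
  simp only [treeApprox, treesUpTo, sum_graft, treeWeight]
  rw [MultilinearMap.map_sum_finset]

theorem one_le_order_treeApprox (hd : d ≠ 0) (h : ι → (Fin d → ι) → R) (m : ℕ) (i : ι) :
    1 ≤ (treeApprox h m i).order := by
  rw [MvPowerSeries.one_le_order_iff_constCoeff_eq_zero]
  induction m generalizing i with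
  | zero => simp [treeApprox, treesUpTo]
  | succ m ih =>
    rw [treeApprox_succ, Pi.add_apply, map_add, MvPowerSeries.constantCoeff_X, zero_add,
      multiForm_apply, map_sum]
    refine Finset.sum_eq_zero fun j _ => ?_
    rw [MvPowerSeries.constantCoeff_smul, map_prod,
      Finset.prod_eq_zero (Finset.mem_univ ⟨0, by omega⟩) (ih _), smul_zero]

theorem le_order_sub_treeApprox (hd : 2 ≤ d) {x : ι → MvPowerSeries ι R}
    (hx : ∀ i, 1 ≤ (x i).order) (hs : x - multiForm h (fun _ => x) = MvPowerSeries.X) (m : ℕ)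
    (i : ι) : (m : ℕ∞) ≤ (x i - treeApprox h m i).order := by
  induction m generalizing i with
  | zero => simp
  | succ m ih =>
    have hsub : x i - treeApprox h (m + 1) i
        = multiForm h (fun _ => x) i - multiForm h (fun _ => treeApprox h m) i := by
      have := congrFun hs i
      rw [Pi.sub_apply] at this
      rw [treeApprox_succ, Pi.add_apply]
      linear_combination this
    rw [hsub]
    exact le_order_multiForm_sub hd h hx (one_le_order_treeApprox (by omega) h m) ih i

theorem le_order_treeApprox_sub (hd : 2 ≤ d) (h : ι → (Fin d → ι) → R) (m q : ℕ) (i : ι) :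
    (m : ℕ∞) ≤ (treeApprox h (m + q) i - treeApprox h m i).order := by
  induction m generalizing i with
  | zero => simp
  | succ m ih =>
    rw [Nat.add_right_comm, treeApprox_succ, treeApprox_succ, Pi.add_apply, Pi.add_apply,
      add_sub_add_left_eq_sub]
    exact le_order_multiForm_sub hd h (one_le_order_treeApprox (by omega) h _)
      (one_le_order_treeApprox (by omega) h m) ih i

/-- The coefficientwise limit of the series `treeApprox h m`. -/
noncomputable def treeLimit (h : ι → (Fin d → ι) → R) (i : ι) : MvPowerSeries ι R :=
  fun α => MvPowerSeries.coeff α (treeApprox h (α.degree + 1) i)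

theorem le_order_treeLimit_sub (hd : 2 ≤ d) (h : ι → (Fin d → ι) → R) (m : ℕ) (i : ι) :
    (m : ℕ∞) ≤ (treeLimit h i - treeApprox h m i).order := by
  rw [natCast_le_order_iff]
  intro α hα
  obtain ⟨q, rfl⟩ := Nat.exists_eq_add_of_le (Nat.succ_le_of_lt hα)
  have hstable := natCast_le_order_iff.1 (le_order_treeApprox_sub hd h (α.degree + 1) q i) α
    (Nat.lt_succ_self _)
  rw [map_sub, sub_eq_zero] at hstable ⊢
  exact hstable.symm

theorem one_le_order_treeLimit (hd : 2 ≤ d) (h : ι → (Fin d → ι) → R) (i : ι) :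
    1 ≤ (treeLimit h i).order := by
  simpa [treeApprox, treesUpTo] using
    (le_min (le_order_treeLimit_sub hd h 1 i) (one_le_order_treeApprox (by omega) h 1 i)).trans
      MvPowerSeries.min_order_le_add

theorem treeLimit_sub_multiForm (hd : 2 ≤ d) (h : ι → (Fin d → ι) → R) :
    treeLimit h - multiForm h (fun _ => treeLimit h) = MvPowerSeries.X := by
  funext i
  ext α
  have hlimit := natCast_le_order_iff.1 (le_order_treeLimit_sub hd h (α.degree + 1 + 1) i) α
    (by omega)
  have hform := natCast_le_order_iff.1 (le_order_multiForm_sub hd h (one_le_order_treeLimit hd h)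
    (one_le_order_treeApprox (by omega) h _) (le_order_treeLimit_sub hd h (α.degree + 1)) i) α
    (by omega)
  rw [treeApprox_succ, Pi.add_apply, map_sub, map_add] at hlimit
  rw [map_sub] at hform
  rw [Pi.sub_apply, map_sub]
  linear_combination hlimit - hform

theorem coe_treeWeight (h : ι → (Fin d → ι) → R) (T : DTree d) (i : ι) :
    ((treeWeight h X T i : MvPolynomial ι R) : MvPowerSeries ι R)
      = treeWeight h MvPowerSeries.X T i := by
  simpa using map_treeWeight (coeToMvPowerSeries.algHom R) h X T i

theorem coeff_eq_sum_treeWeight (hd : 2 ≤ d) {x : ι → MvPowerSeries ι R}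
    (hx : ∀ i, 1 ≤ (x i).order) (hs : x - multiForm h (fun _ => x) = MvPowerSeries.X) (i : ι)
    {k : ℕ} {α : ι →₀ ℕ} (hα : α.degree = (d - 1) * k + 1) :
    MvPowerSeries.coeff α (x i)
      = ∑ T : CatalanTree d k, (treeWeight h X T.1 i : MvPolynomial ι R).coeff α := by
  have happrox := natCast_le_order_iff.1 (le_order_sub_treeApprox hd hx hs (α.degree + 1) i) α
    (Nat.lt_succ_self _)
  have hk : k < α.degree + 1 := by
    have := Nat.le_mul_of_pos_left k (by omega : 0 < d - 1)
    omega
  have hvanish (T : DTree d) (hT : (treeWeight h X T i : MvPolynomial ι R).coeff α ≠ 0) :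
      T.numInternal = k := by
    by_contra hne
    exact hT (coeff_treeWeight_eq_zero hd h hne i hα)
  rw [map_sub, sub_eq_zero] at happrox
  rw [happrox, sum_catalanTree hk fun T => (treeWeight h X T i : MvPolynomial ι R).coeff α,
    Finset.sum_filter_of_ne fun T _ => hvanish T, treeApprox, Finset.sum_apply, map_sum]
  simp only [← coe_treeWeight, coeff_coe]

end TreeExpansion

section Inverse

variable {d n : ℕ} {H : Fin n → MvPolynomial (Fin n) ℂ} {G : Fin n → MvPowerSeries (Fin n) ℂ}

theorem aeval_idSub (hH : ∀ i, (H i).IsHomogeneous d) {A : Type*} [CommRing A] [Algebra ℂ A]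
    (x : Fin n → A) (i : Fin n) :
    aeval x (idSub H i) = x i - multiForm (symCoeff d H) (fun _ => x) i := by
  rw [idSub, map_sub, aeval_X, aeval_eq_multiForm hH]

theorem IsInverse.one_le_order {F : Fin n → MvPolynomial (Fin n) ℂ} (hG : IsInverse F G)
    (i : Fin n) : 1 ≤ (G i).order :=
  MvPowerSeries.one_le_order_iff_constCoeff_eq_zero.2 (hG.1 i)

theorem IsInverse.sub_multiForm (hH : ∀ i, (H i).IsHomogeneous d) (hG : IsInverse (idSub H) G) :
    G - multiForm (symCoeff d H) (fun _ => G) = MvPowerSeries.X := by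
  funext i
  rw [Pi.sub_apply, ← aeval_idSub hH, hG.2.1]

theorem IsInverse.coeff_eq (hd : 2 ≤ d) (hH : ∀ i, (H i).IsHomogeneous d)
    (hG : IsInverse (idSub H) G) (i : Fin n) {k : ℕ} {α : Fin n →₀ ℕ}
    (hα : α.degree = (d - 1) * k + 1) :
    MvPowerSeries.coeff α (G i) = ∑ T : CatalanTree d k,
      (treeWeight (symCoeff d H) X T.1 i : MvPolynomial (Fin n) ℂ).coeff α :=
  coeff_eq_sum_treeWeight hd hG.one_le_order (hG.sub_multiForm hH) i hα

theorem constantCoeff_idSub (hd : d ≠ 0) (hH : ∀ i, (H i).IsHomogeneous d) (i : Fin n) :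
    MvPowerSeries.constantCoeff (idSub H i : MvPowerSeries (Fin n) ℂ) = 0 := by
  rw [← MvPowerSeries.coeff_zero_eq_constantCoeff_apply, coeff_coe, idSub, coeff_sub, coeff_zero_X,
    zero_sub, neg_eq_zero]
  exact (hH i).coeff_eq_zero (by simpa using hd.symm)

theorem subst_idSub_treeLimit (hd : 2 ≤ d) (hH : ∀ i, (H i).IsHomogeneous d) (i : Fin n) :
    MvPowerSeries.subst (fun j => (idSub H j : MvPowerSeries (Fin n) ℂ))
      (treeLimit (symCoeff d H) i) = MvPowerSeries.X i := by
  have hF0 := constantCoeff_idSub (by omega) hH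
  have hF := MvPowerSeries.hasSubst_of_constantCoeff_zero hF0
  suffices heq : (fun i => MvPowerSeries.subst (fun j => (idSub H j : MvPowerSeries (Fin n) ℂ))
      (treeLimit (symCoeff d H) i)) = MvPowerSeries.X from congrFun heq i
  refine sub_multiForm_injective hd (h := symCoeff d H) (fun i => ?_) (fun i => ?_)
    (funext fun i => ?_)
  · rw [MvPowerSeries.one_le_order_iff_constCoeff_eq_zero]
    exact MvPowerSeries.constantCoeff_subst_eq_zero hF hF0
      (MvPowerSeries.one_le_order_iff_constCoeff_eq_zero.1 (one_le_order_treeLimit hd _ i))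
  · rw [MvPowerSeries.one_le_order_iff_constCoeff_eq_zero, MvPowerSeries.constantCoeff_X]
  · have hsubst := congrArg (MvPowerSeries.substAlgHom (R := ℂ) hF)
      (congrFun (treeLimit_sub_multiForm hd (symCoeff d H)) i)
    rw [Pi.sub_apply, map_sub, map_multiForm, MvPowerSeries.substAlgHom_X] at hsubst
    simp only [MvPowerSeries.substAlgHom_apply] at hsubst
    rw [Pi.sub_apply, Pi.sub_apply, hsubst, ← aeval_idSub hH, ← MvPowerSeries.subst_coe,
      MvPowerSeries.subst_self, id]

theorem existsUnique_isInverse (hd : 2 ≤ d) (hH : ∀ i, (H i).IsHomogeneous d) :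
    ∃! G, IsInverse (idSub H) G := by
  refine ⟨treeLimit (symCoeff d H), ⟨fun i => ?_, fun i => ?_, subst_idSub_treeLimit hd hH⟩,
    fun G hG => ?_⟩
  · exact MvPowerSeries.one_le_order_iff_constCoeff_eq_zero.1 (one_le_order_treeLimit hd _ i)
  · exact (aeval_idSub hH _ i).trans (congrFun (treeLimit_sub_multiForm hd _) i)
  · exact sub_multiForm_injective hd hG.one_le_order (one_le_order_treeLimit hd _)
      ((hG.sub_multiForm hH).trans (treeLimit_sub_multiForm hd _).symm)

end Inverse

/-! ### Keller maps have nilpotent Jacobian matrices -/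

section Nilpotent

variable {R σ : Type*}

theorem aeval_X_mul_of_isHomogeneous [CommSemiring R] {m : ℕ} {f : MvPolynomial σ R}
    (hf : f.IsHomogeneous m) :
    aeval (fun i => (Polynomial.X * Polynomial.C (X i) : Polynomial (MvPolynomial σ R))) f
      = Polynomial.X ^ m * Polynomial.C f := by
  conv_rhs => rw [← support_sum_monomial_coeff f]
  rw [aeval_def, eval₂_eq, map_sum, Finset.mul_sum]
  refine Finset.sum_congr rfl fun α hα => ?_
  have hdeg : ∑ i ∈ α.support, α i = m := by
    by_contra hne
    exact mem_support_iff.1 hα (hf.coeff_eq_zero hne)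
  simp_rw [mul_pow]
  rw [Finset.prod_mul_distrib, Finset.prod_pow_eq_pow_sum, hdeg, monomial_eq, Finsupp.prod,
    Polynomial.C_mul, map_prod, mul_left_comm]
  simp only [map_pow]
  rfl

variable [CommRing R] {ι : Type*} [Fintype ι] [DecidableEq ι]

theorem expand_charpolyRev {S : Type*} [CommRing S] (M : Matrix ι ι S) (e : ℕ) :
    Polynomial.expand S e M.charpolyRev
      = (1 - (Polynomial.X ^ e : Polynomial S) • M.map Polynomial.C).det := by
  rw [Matrix.charpolyRev, AlgHom.map_det]
  congr 1
  ext i j : 2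
  by_cases hij : i = j <;> simp [hij]

theorem charpoly_eq_X_pow_of_charpolyRev_eq_one {S : Type*} [CommRing S] {M : Matrix ι ι S}
    (hM : M.charpolyRev = 1) : M.charpoly = Polynomial.X ^ Fintype.card ι := by
  nontriviality S
  rw [← Matrix.reverse_charpoly, Polynomial.reverse, Matrix.charpoly_natDegree_eq_dim] at hM
  rw [← Polynomial.reflect_reflect (p := M.charpoly) (N := Fintype.card ι), hM,
    Polynomial.reflect_one]

theorem charpolyRev_eq_one_of_det_one_sub {e : ℕ} (he : e ≠ 0)
    {M : Matrix ι ι (MvPolynomial σ R)} (hM : ∀ i j, (M i j).IsHomogeneous e) {c : R}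
    (hdet : (1 - M).det = C c) : M.charpolyRev = 1 := by
  let scale := aeval (R := R)
    fun i => (Polynomial.X * Polynomial.C (X i) : Polynomial (MvPolynomial σ R))
  have hscale : scale.mapMatrix (1 - M)
      = 1 - (Polynomial.X ^ e : Polynomial (MvPolynomial σ R)) • M.map Polynomial.C := by
    rw [map_sub, map_one]
    congr 1
    ext1 i j
    exact aeval_X_mul_of_isHomogeneous (hM i j)
  have hconst : M.charpolyRev = Polynomial.C (C c) := by
    refine Polynomial.expand_injective (Nat.pos_of_ne_zero he) ?_
    rw [expand_charpolyRev, ← hscale, ← AlgHom.map_det, hdet, Polynomial.expand_C]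
    exact aeval_C _ c
  have heval := M.eval_charpolyRev
  rw [hconst, Polynomial.eval_C] at heval
  rw [hconst, heval, Polynomial.C_1]

theorem pow_card_eq_zero_of_det_one_sub {e : ℕ} (he : e ≠ 0)
    {M : Matrix ι ι (MvPolynomial σ R)} (hM : ∀ i j, (M i j).IsHomogeneous e) {c : R}
    (hdet : (1 - M).det = C c) : M ^ Fintype.card ι = 0 := by
  have hcayley := M.aeval_self_charpoly
  rwa [charpoly_eq_X_pow_of_charpolyRev_eq_one (charpolyRev_eq_one_of_det_one_sub he hM hdet),
    map_pow, Polynomial.aeval_X] at hcayley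

end Nilpotent

theorem jacobian_idSub {n : ℕ} (H : Fin n → MvPolynomial (Fin n) ℂ) :
    jacobian (idSub H) = 1 - jacobian H := by
  ext1 i j
  simp only [jacobian, idSub, Matrix.of_apply, map_sub, pderiv_X, Matrix.sub_apply,
    Matrix.one_apply, Pi.single_apply]

theorem IsKeller.jacobian_pow_eq_zero {d n : ℕ} (hd : 2 ≤ d) {H : Fin n → MvPolynomial (Fin n) ℂ}
    (hH : ∀ i, (H i).IsHomogeneous d) (hK : IsKeller (idSub H)) : jacobian H ^ n = 0 := by
  obtain ⟨c, -, hc⟩ := hK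
  rw [jacobian_idSub] at hc
  simpa only [Fintype.card_fin] using pow_card_eq_zero_of_det_one_sub (M := jacobian H)
    (by omega : d - 1 ≠ 0) (fun i j => (hH i).pderiv) hc

/-! ### Bounds for the coefficients of the inverse -/

section Bounds

variable {d n k : ℕ}

theorem treeBound_nonneg (α : Fin n →₀ ℕ) (L : NNReal) : 0 ≤ treeBound d n k α L := by
  rw [treeBound]
  positivity

theorem coeffBound_nonneg (hd : d ≠ 0) (α : Fin n →₀ ℕ) (L : NNReal) :
    0 ≤ coeffBound d n k α L :=
  coeffBound_eq hd n k α L ▸ mul_nonneg (Nat.cast_nonneg _) (treeBound_nonneg α L)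

theorem card_mul_norm1 (f : CatalanTree d k → ℂ) :
    Fintype.card (CatalanTree d k) * norm1 f = ∑ T, ‖f T‖ := by
  rw [norm1]
  rcases isEmpty_or_nonempty (CatalanTree d k) with hempty | hnonempty
  · simp
  · exact mul_div_cancel₀ _ (by exact_mod_cast Fintype.card_ne_zero)

variable {H : Fin n → MvPolynomial (Fin n) ℂ} {G : Fin n → MvPowerSeries (Fin n) ℂ}

theorem norm_coeff_inverse_le (hd : 2 ≤ d) (hH : ∀ i, (H i).IsHomogeneous d)
    (hG : IsInverse (idSub H) G) (hk : k ≠ 0) (i : Fin n) {α : Fin n →₀ ℕ}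
    (hα : α.degree = (d - 1) * k + 1) :
    ‖MvPowerSeries.coeff α (G i)‖ ≤ coeffBound d n k α (maxCoeff d H) := by
  rw [hG.coeff_eq hd hH i hα, coeffBound_eq (by omega), ← nsmul_eq_mul]
  exact (norm_sum_le _ _).trans (Finset.sum_le_card_nsmul _ _ _ fun T _ =>
    norm_coeff_treeWeight_le (by omega) hk H T i hα)

theorem norm_coeff_inverse_extremal (hd : 2 ≤ d) (L : NNReal)
    (hG : IsInverse (idSub (extremal d n ((L : ℝ) : ℂ))) G) (hk : k ≠ 0) (i : Fin n)
    {α : Fin n →₀ ℕ} (hα : α.degree = (d - 1) * k + 1) :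
    ‖MvPowerSeries.coeff α (G i)‖ = coeffBound d n k α L := by
  have hcoeff : MvPowerSeries.coeff α (G i) = (coeffBound d n k α L : ℂ) := by
    rw [hG.coeff_eq hd (isHomogeneous_extremal d n _) i hα, coeffBound_eq (by omega),
      symCoeff_extremal]
    simp_rw [coeff_treeWeight_const (by omega : d ≠ 0) hk _ _ i hα]
    rw [Finset.sum_const, Finset.card_univ, nsmul_eq_mul, treeBound]
    push_cast
    rfl
  rw [hcoeff, Complex.norm_real, Real.norm_of_nonneg (coeffBound_nonneg (by omega) α L)]

theorem norm_coeff_inverse_le_of_mem_shuffleSpan {p : ℕ} (hd : 2 ≤ d)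
    (hH : ∀ i, (H i).IsHomogeneous d) (hJ : jacobian H ^ p = 0) (hG : IsInverse (idSub H) G)
    (hk : k ≠ 0) {φ : CatalanTree d k → ℂ} (hφ : φ ∈ shuffleSpan d k p) (i : Fin n)
    {α : Fin n →₀ ℕ} (hα : α.degree = (d - 1) * k + 1) :
    ‖MvPowerSeries.coeff α (G i)‖
      ≤ coeffBound d n k α (maxCoeff d H) * norm1 (fun T => φ T - 1) := by
  let w (T : CatalanTree d k) : ℂ :=
    (treeWeight (symCoeff d H) X T.1 i : MvPolynomial (Fin n) ℂ).coeff α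
  have horthogonal : ∑ T, φ T * w T = 0 := by
    have := congrArg (coeff α) (congrFun (sum_smul_treeWeight_eq_zero_of_mem_shuffleSpan
      (spineMap_const_eq_zero (by omega) hH hJ) (X : Fin n → MvPolynomial (Fin n) ℂ) hφ) i)
    simpa [coeff_sum] using this
  have hexpand : MvPowerSeries.coeff α (G i) = -∑ T, (φ T - 1) * w T := by
    simp_rw [sub_mul, one_mul]
    rw [Finset.sum_sub_distrib, horthogonal, zero_sub, neg_neg, hG.coeff_eq hd hH i hα]
  rw [hexpand, norm_neg, coeffBound_eq (by omega), mul_right_comm, card_mul_norm1, Finset.sum_mul]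
  refine (norm_sum_le _ _).trans (Finset.sum_le_sum fun T _ => ?_)
  rw [norm_mul]
  exact mul_le_mul_of_nonneg_left (norm_coeff_treeWeight_le (by omega) hk H T i hα)
    (norm_nonneg _)

theorem exists_exp_bound_of_jacobian_pow_eq_zero (hd : 2 ≤ d) (p : ℕ) :
    ∃ C c : ℝ, 0 < C ∧ 0 < c ∧
      (∀ k : ℕ, 1 ≤ k → ∃ φ ∈ shuffleSpan d k p,
        norm1 (fun T => φ T - 1) ≤ C * Real.exp (-c * k)) ∧
      ∀ (n : ℕ) (H : Fin n → MvPolynomial (Fin n) ℂ), (∀ i, (H i).IsHomogeneous d) →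
        jacobian H ^ p = 0 → ∀ G : Fin n → MvPowerSeries (Fin n) ℂ, IsInverse (idSub H) G →
        ∀ k : ℕ, 1 ≤ k → ∀ (i : Fin n) (α : Fin n →₀ ℕ), α.degree = (d - 1) * k + 1 →
          ‖MvPowerSeries.coeff α (G i)‖
            ≤ coeffBound d n k α (maxCoeff d H) * (C * Real.exp (-c * k)) := by
  obtain ⟨C, c, hC, hc, happrox⟩ := exists_mem_shuffleSpan_norm1_le hd p
  refine ⟨C, c, hC, hc, happrox, fun n H hH hJ G hG k hk i α hα => ?_⟩
  obtain ⟨φ, hφ, hle⟩ := happrox k hk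
  exact (norm_coeff_inverse_le_of_mem_shuffleSpan hd hH hJ hG (by omega) hφ i hα).trans
    (mul_le_mul_of_nonneg_left hle (coeffBound_nonneg (by omega) α _))

end Bounds

end KellerTree

theorem theorem4p4 (d : ℕ) (hd : 2 ≤ d) :
    -- the power series inverse exists and is unique
    (∀ (n : ℕ) (H : Fin n → MvPolynomial (Fin n) ℂ), (∀ i, (H i).IsHomogeneous d) →
      ∃! G : Fin n → MvPowerSeries (Fin n) ℂ, KellerTree.IsInverse (KellerTree.idSub H) G) ∧
    -- the general bound
    (∀ (n : ℕ) (H : Fin n → MvPolynomial (Fin n) ℂ), (∀ i, (H i).IsHomogeneous d) →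
      ∀ G : Fin n → MvPowerSeries (Fin n) ℂ, KellerTree.IsInverse (KellerTree.idSub H) G →
      ∀ (k : ℕ), 1 ≤ k → ∀ (i : Fin n) (α : Fin n →₀ ℕ), α.degree = (d - 1) * k + 1 →
        ‖MvPowerSeries.coeff α (G i)‖
          ≤ KellerTree.coeffBound d n k α (KellerTree.maxCoeff d H)) ∧
    -- its sharpness, for every dimension and every value of `L`
    (∀ (n : ℕ), 1 ≤ n → ∀ L : NNReal,
      ∃ H : Fin n → MvPolynomial (Fin n) ℂ, (∀ i, (H i).IsHomogeneous d) ∧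
        KellerTree.maxCoeff d H = L ∧
        ∀ G : Fin n → MvPowerSeries (Fin n) ℂ, KellerTree.IsInverse (KellerTree.idSub H) G →
        ∀ (k : ℕ), 1 ≤ k → ∀ (i : Fin n) (α : Fin n →₀ ℕ), α.degree = (d - 1) * k + 1 →
          ‖MvPowerSeries.coeff α (G i)‖ = KellerTree.coeffBound d n k α L) ∧
    -- the bound for nilpotent Jacobians, for every function in the span of shuffle indicators
    (∀ (p : ℕ), 1 ≤ p →
      ∀ (n : ℕ) (H : Fin n → MvPolynomial (Fin n) ℂ), (∀ i, (H i).IsHomogeneous d) →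
      (KellerTree.jacobian H) ^ p = 0 →
      ∀ G : Fin n → MvPowerSeries (Fin n) ℂ, KellerTree.IsInverse (KellerTree.idSub H) G →
      ∀ (k : ℕ), 1 ≤ k → ∀ φ ∈ KellerTree.shuffleSpan d k p,
      ∀ (i : Fin n) (α : Fin n →₀ ℕ), α.degree = (d - 1) * k + 1 →
        ‖MvPowerSeries.coeff α (G i)‖
          ≤ KellerTree.coeffBound d n k α (KellerTree.maxCoeff d H)
            * KellerTree.norm1 (fun T => φ T - 1)) ∧
    -- the exponential improvement; `C` and `c` depend on `d` and `p` only
    (∀ (p : ℕ), 1 ≤ p → ∃ C c : ℝ, 0 < C ∧ 0 < c ∧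
      (∀ (k : ℕ), 1 ≤ k → ∃ φ ∈ KellerTree.shuffleSpan d k p,
        KellerTree.norm1 (fun T => φ T - 1) ≤ C * Real.exp (-c * k)) ∧
      (∀ (n : ℕ) (H : Fin n → MvPolynomial (Fin n) ℂ), (∀ i, (H i).IsHomogeneous d) →
        (KellerTree.jacobian H) ^ p = 0 →
        ∀ G : Fin n → MvPowerSeries (Fin n) ℂ, KellerTree.IsInverse (KellerTree.idSub H) G →
        ∀ (k : ℕ), 1 ≤ k → ∀ (i : Fin n) (α : Fin n →₀ ℕ), α.degree = (d - 1) * k + 1 →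
          ‖MvPowerSeries.coeff α (G i)‖
            ≤ KellerTree.coeffBound d n k α (KellerTree.maxCoeff d H)
              * (C * Real.exp (-c * k)))) ∧
    -- hence for Keller maps; here `C` and `c` depend on `d` and `n` only
    (∀ (n : ℕ), ∃ C c : ℝ, 0 < C ∧ 0 < c ∧
      ∀ H : Fin n → MvPolynomial (Fin n) ℂ, (∀ i, (H i).IsHomogeneous d) →
        KellerTree.IsKeller (KellerTree.idSub H) →
        ∀ G : Fin n → MvPowerSeries (Fin n) ℂ, KellerTree.IsInverse (KellerTree.idSub H) G →
        ∀ (k : ℕ), 1 ≤ k → ∀ (i : Fin n) (α : Fin n →₀ ℕ), α.degree = (d - 1) * k + 1 →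
          ‖MvPowerSeries.coeff α (G i)‖
            ≤ KellerTree.coeffBound d n k α (KellerTree.maxCoeff d H)
              * (C * Real.exp (-c * k))) := by
  refine ⟨fun n H hH => KellerTree.existsUnique_isInverse hd hH,
    fun n H hH G hG k hk i α hα => KellerTree.norm_coeff_inverse_le hd hH hG (by omega) i hα,
    fun n hn L => ⟨KellerTree.extremal d n ((L : ℝ) : ℂ), KellerTree.isHomogeneous_extremal d n _,
      KellerTree.maxCoeff_extremal d (by omega) L, fun G hG k hk i α hα =>
        KellerTree.norm_coeff_inverse_extremal hd L hG (by omega) i hα⟩,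
    fun p _ n H hH hJ G hG k hk φ hφ i α hα =>
      KellerTree.norm_coeff_inverse_le_of_mem_shuffleSpan hd hH hJ hG (by omega) hφ i hα,
    fun p _ => KellerTree.exists_exp_bound_of_jacobian_pow_eq_zero hd p, fun n => ?_⟩
  obtain ⟨C, c, hC, hc, -, hbound⟩ := KellerTree.exists_exp_bound_of_jacobian_pow_eq_zero hd n
  exact ⟨C, c, hC, hc, fun H hH hK => hbound n H hH (hK.jacobian_pow_eq_zero hd hH)⟩
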